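/- **Setting.** A continuous language $\tau$ consists of function symbols $F$ and predicate symbols $R$ with finite arities, each with a modulus of uniform continuity $\Delta_F,\Delta_R:(0,1]\to(0,1]$; $|\tau|$ is the number of these symbols. A continuous $\tau$-structure is a nonempty complete metric space $(M,d)$ with $d\le 1$, with functions $F^M:M^n\to M$ and predicates $R^M:M^n\to[0,1]$ such that for all $\varepsilon\in(0,1]$: if $d(x_i,y_i)<\Delta_F(\varepsilon)$ for all $i$ then $d(F^M(\mathbf x),F^M(\mathbf y))\le\varepsilon$, and if $d(x_i,y_i)<\Delta_R(\varepsilon)$ for all $i$ then $|R^M(\mathbf x)-R^M(\mathbf y)|\le\varepsilon$. Continuous formulas are built from atomic formulas $R(\mathbf t)$, $d(t,t')$ with the connectives $0$, $1$, $x/2$, $x\mathbin{\dot-}y=\max(x-y,0)$ and the quantifiers $\sup_y$, $\inf_y$. A continuous theory $T$ is a set of closed conditions "$\phi=0$" ($\phi$ without free variables); it need not be complete. **Discrete stability.** For $A\subseteq M$ let $T_A$ be the theory of $(M,a)_{a\in A}$, and let $S_1(T_A)$ be the set of complete $1$-types over $A$, i.e. of the sets $\{\text{“}\phi(x,\mathbf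 a)=0\text{”}:\phi^N(e,\mathbf a)=0\}$ with $N\vDash T_A$ and $e\in N$. $T$ is *$\lambda$-discrete stable* if $|S_1(T_A)|\le\lambda$ for every $M\vDash T$ and every $A\subseteq M$ with $|A|\le\lambda$. **The discrete language and theory.** Let $\mathbb Q'=\mathbb Q\cap[0,1]$. The discrete language $\tau^+$ has the function symbols of $\tau$ and, for every continuous formula $\phi(\mathbf x)$ and $r\in\mathbb Q'$, relation symbols $R_{\phi\ge r}$, $R_{\phi\le r}$ of arity $\ell(\mathbf x)$. For rational $q\notin[0,1]$, read $R_{\phi\ge q}$ as true if $q<0$ and false if $q>1$, and $R_{\phi\le q}$ as false if $q<0$ and true if $q>1$. $T_{dense}$ is the $\mathbb L_{\omega_1,\omega}(\tau^+)$-theory consisting of the universal closures of the following, for all continuous formulas $\phi,\psi$, terms $\mathbf t$, and $r,s\in\mathbb Q'$, $m$ ranging over the positive integers: 1. $\neg R_{\phi\ge r}\to R_{\phi\le r}$; $\neg R_{\phi\le r}\to R_{\phi\ge r}$; $\neg R_{\phi\ge r}\vee\neg R_{\phi\le s}$ if $r>s$; $R_{\phi\le s}\to R_{\phi\le r}$ and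 $R_{\phi\ge r}\to R_{\phi\ge s}$ if $r\ge s$; $R_{\phi\ge r}\vee R_{\phi\le r}$; $\bigwedge_m\bigvee_{r,s\in\mathbb Q',|r-s|<1/m}(R_{\phi\le r}\wedge R_{\phi\ge s})$; $\bigwedge_m R_{\phi\ge r-1/m}\to R_{\phi\ge r}$; $\bigwedge_m R_{\phi\le r+1/m}\to R_{\phi\le r}$. 2. $R_{\phi\ge0}\wedge R_{\phi\le1}$; $\neg R_{0\ge t}\wedge\neg R_{1\le 1-t}$ for $t\in\mathbb Q'\setminus\{0\}$; $R_{\phi/2\ge r}\leftrightarrow R_{\phi\ge 2r}$; $R_{\phi/2\le r}\leftrightarrow R_{\phi\le 2r}$; $R_{\phi\dot-\psi\ge r}\leftrightarrow\bigwedge_m\bigvee_{s\in\mathbb Q'}(R_{\psi\le s}\wedge R_{\phi\ge r+s-1/m})$ for $r>0$; $R_{\phi\dot-\psi\le r}\leftrightarrow\bigwedge_m\bigvee_{s\in\mathbb Q'}(R_{\psi\ge s}\wedge R_{\phi\le r+s+1/m})$; $R_{\sup_y\phi\le r}(\mathbf x)\leftrightarrow\forall y\,R_{\phi\le r}(\mathbf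 x,y)$; $R_{\sup_y\phi\ge r}(\mathbf x)\leftrightarrow\bigwedge_m\exists y\,R_{\phi\ge r-1/m}(\mathbf x,y)$; $R_{\inf_y\phi\le r}(\mathbf x)\leftrightarrow\bigwedge_m\exists y\,R_{\phi\le r+1/m}(\mathbf x,y)$; $R_{\inf_y\phi\ge r}(\mathbf x)\leftrightarrow\forall y\,R_{\phi\ge r}(\mathbf x,y)$; and, for $\square\in\{\le,\ge\}$, $R_{\phi\,\square\, r}(\mathbf t(\mathbf x))\leftrightarrow R_{\phi(\mathbf t)\,\square\, r}(\mathbf x)$. 3. $R_{d\le0}(x,x')\leftrightarrow x=x'$; $R_{d\,\square\, r}(x,x')\leftrightarrow R_{d\,\square\, r}(x',x)$; $\bigwedge_{r\in\mathbb Q'}\bigl(R_{d\ge r}(x,x')\to\forall x''\bigwedge_m\bigvee_{s\in\mathbb Q'\cap[0,r]}(R_{d\ge s}(x,x'')\wedge R_{d\ge r-s-1/m}(x'',x'))\bigr)$. 4. For real $\varepsilon\in(0,1]$ and $r,s\in\mathbb Q'$ with $r\ge\varepsilon$: $\bigwedge_i R_{d\le s}(x_i,y_i)\to R_{d\le r}(F(\mathbf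 x),F(\mathbf y))$ if $s<\Delta_F(\varepsilon)$, and $\bigwedge_i R_{d\le s}(x_i,y_i)\to R_{R(\mathbf z)\dot-R(\mathbf z')\le r}(\mathbf x,\mathbf y)\wedge R_{R(\mathbf z)\dot-R(\mathbf z')\le r}(\mathbf y,\mathbf x)$ if $s<\Delta_R(\varepsilon)$. Put $T^*=T_{dense}\cup\{R_{\phi\le0}:\text{“}\phi=0\text{”}\in T\}$ and let $K=(\mathrm{Mod}(T^*),\subset_{\tau^+})$ be the class of nonempty models of $T^*$ with the $\tau^+$-substructure relation. **Galois stability.** For $D\in K$, Galois types over $D$ are classes of pairs $(N,a)$ with $D\subset_{\tau^+}N\in K$ and $a\in N$, under the equivalence relation generated by: $(N_1,a_1)\sim(N_2,a_2)$ iff there are $N\in K$ and $\tau^+$-embeddings $f_i:N_i\to N$ that agree on $D$ and satisfy $f_1(a_1)=f_2(a_2)$. $K$ is *$\lambda$-Galois stable* if for every $D\in K$ with $|D|=\lambda$ there are at most $\lambda$ Galois types over $D$. **Statement.** Let $T$ be a continuous theory in a continuous language $\tau$, and let $\lambda\ge|\tau|+\aleph_0$ be a cardinal. Then $T$ is $\lambda$-discrete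 stable if and only if $(\mathrm{Mod}(T^*),\subset_{\tau^+})$ is $\lambda$-Galois stable. -/

import Mathlib

open Cardinal
open scoped FirstOrder

universe u

namespace ContLogic

/-! ### Continuous first-order logic (one-sorted, `[0,1]`-valued) -/

/-- A continuous language: function and predicate symbols with arities, each with a modulus of
uniform continuity `Δ : (0,1] → (0,1]` (only the values on `(0,1]` matter). Constants are function
symbols of arity `0`; the metric `d` is a logical symbol. -/
structure Lang where
  Functions : ℕ → Type u
  Relations : ℕ → Type u
  funMod : ∀ {n : ℕ}, Functions n → ℝ → ℝ
  relMod : ∀ {n : ℕ}, Relations n → ℝ → ℝ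
  funMod_mem : ∀ {n : ℕ} (f : Functions n) (ε : ℝ), ε ∈ Set.Ioc (0 : ℝ) 1 →
    funMod f ε ∈ Set.Ioc (0 : ℝ) 1
  relMod_mem : ∀ {n : ℕ} (R : Relations n) (ε : ℝ), ε ∈ Set.Ioc (0 : ℝ) 1 →
    relMod R ε ∈ Set.Ioc (0 : ℝ) 1

namespace Lang

variable (τ : Lang.{u})

/-- The number of nonlogical symbols. -/
noncomputable def card : Cardinal.{u} :=
  #(Σ n, τ.Functions n) + #(Σ n, τ.Relations n)

/-- The function symbols as a Mathlib language, used only to form terms. -/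
def funLang : FirstOrder.Language.{u, u} where
  Functions := τ.Functions
  Relations := fun _ => PEmpty

/-- Terms in the variables `x_0, …, x_{n-1}`. -/
abbrev Term (n : ℕ) : Type u := τ.funLang.Term (Fin n)

/-- `τ.Fml n`: continuous formulas in the free variables `x_0, …, x_{n-1}`, built with the
connectives `0`, `1`, `x / 2`, `x ∸ y` and the quantifiers `sup`, `inf`, which bind the
last variable `x_n` of a formula in `n + 1` variables. -/
inductive Fml : ℕ → Type u
  | rel {n k : ℕ} (R : τ.Relations k) (ts : Fin k → τ.Term n) : Fml n
  | dist {n : ℕ} (s t : τ.Term n) : Fml n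
  | zero {n : ℕ} : Fml n
  | one {n : ℕ} : Fml n
  | half {n : ℕ} (φ : Fml n) : Fml n
  | monus {n : ℕ} (φ ψ : Fml n) : Fml n
  | sup {n : ℕ} (φ : Fml (n + 1)) : Fml n
  | inf {n : ℕ} (φ : Fml (n + 1)) : Fml n

end Lang

variable {τ : Lang.{u}}

/-- Extend a substitution under a quantifier: the new last variable is left alone. -/
def liftSubst {n m : ℕ} (ts : Fin n → τ.Term m) : Fin (n + 1) → τ.Term (m + 1) :=
  Fin.snoc (α := fun _ => τ.Term (m + 1)) (fun i => (ts i).relabel Fin.castSucc)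
    (FirstOrder.Language.Term.var (Fin.last m))

/-- Simultaneous capture-free substitution of terms for the free variables. -/
def Lang.Fml.subst : {n m : ℕ} → τ.Fml n → (Fin n → τ.Term m) → τ.Fml m
  | _, _, .rel R us, ts => .rel R fun i => (us i).subst ts
  | _, _, .dist s t, ts => .dist (s.subst ts) (t.subst ts)
  | _, _, .zero, _ => .zero
  | _, _, .one, _ => .one
  | _, _, .half φ, ts => .half (φ.subst ts)
  | _, _, .monus φ ψ, ts => .monus (φ.subst ts) (ψ.subst ts)
  | _, _, .sup φ, ts => .sup (φ.subst (liftSubst ts))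
  | _, _, .inf φ, ts => .inf (φ.subst (liftSubst ts))

/-- Continuous `τ`-structures: nonempty complete metric spaces of diameter at most `1`, with
functions and `[0,1]`-valued predicates that respect the moduli of the language. -/
class CStructure (τ : Lang.{u}) (M : Type u) [MetricSpace M] where
  nonempty : Nonempty M
  complete : CompleteSpace M
  dist_le_one : ∀ x y : M, dist x y ≤ 1
  funMap : ∀ {n : ℕ}, τ.Functions n → (Fin n → M) → M
  relMap : ∀ {n : ℕ}, τ.Relations n → (Fin n → M) → ℝ
  relMap_mem : ∀ {n : ℕ} (R : τ.Relations n) (x : Fin n → M), relMap R x ∈ Set.Icc (0 : ℝ) 1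
  funMap_unif : ∀ {n : ℕ} (f : τ.Functions n) (ε : ℝ), ε ∈ Set.Ioc (0 : ℝ) 1 →
    ∀ x y : Fin n → M, (∀ i, dist (x i) (y i) < τ.funMod f ε) →
      dist (funMap f x) (funMap f y) ≤ ε
  relMap_unif : ∀ {n : ℕ} (R : τ.Relations n) (ε : ℝ), ε ∈ Set.Ioc (0 : ℝ) 1 →
    ∀ x y : Fin n → M, (∀ i, dist (x i) (y i) < τ.relMod R ε) →
      |relMap R x - relMap R y| ≤ ε

instance (τ : Lang.{u}) (M : Type u) [MetricSpace M] [CStructure τ M] :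
    τ.funLang.Structure M where
  funMap := fun {_} f x => CStructure.funMap (τ := τ) f x
  RelMap := fun {_} R _ => PEmpty.elim R

/-- The value `φ^M(x) ∈ [0,1]`. -/
noncomputable def Lang.Fml.eval {M : Type u} [MetricSpace M] [CStructure τ M] :
    {n : ℕ} → τ.Fml n → (Fin n → M) → ℝ
  | _, .rel R ts, x => CStructure.relMap R fun i => (ts i).realize x
  | _, .dist s t, x => Dist.dist (s.realize x) (t.realize x)
  | _, .zero, _ => 0
  | _, .one, _ => 1
  | _, .half φ, x => φ.eval x / 2
  | _, .monus φ ψ, x => max (φ.eval x - ψ.eval x) 0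
  | _, .sup φ, x => ⨆ a : M, φ.eval (Fin.snoc (α := fun _ => M) x a)
  | _, .inf φ, x => ⨅ a : M, φ.eval (Fin.snoc (α := fun _ => M) x a)

/-- A continuous theory is a set `T` of closed formulas `φ`, standing for the closed conditions
`φ = 0`; this says that all of these hold in `M`. -/
def CModels (M : Type u) [MetricSpace M] [CStructure τ M] (T : Set (τ.Fml 0)) : Prop :=
  ∀ φ ∈ T, φ.eval (M := M) Fin.elim0 = 0

/-- Conditions `φ(a_1, …, a_k, x) = 0` in one variable `x` (the last variable of `φ`) with
parameters `a_i ∈ A`. -/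
abbrev Cond (τ : Lang.{u}) (A : Type u) : Type u := Σ k : ℕ, τ.Fml (k + 1) × (Fin k → A)

/-- `S_1(T_A)` for `A ⊆ M`, where `T_A` is the theory of `(M, a)_{a ∈ A}`: the sets of conditions
that are the complete set of conditions over `A` satisfied by some element `e` of some model
`(N, c_a)_{a ∈ A}` of `T_A`. -/
def typeSpace (τ : Lang.{u}) {M : Type u} [MetricSpace M] [CStructure τ M] (A : Set M) :
    Set (Set (Cond τ A)) :=
  {p | ∃ (N : Type u) (_ : MetricSpace N) (_ : CStructure τ N) (c : A → N),
    (∀ (k : ℕ) (φ : τ.Fml k) (a : Fin k → A),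
      φ.eval (fun i => (a i : M)) = 0 → φ.eval (fun i => c (a i)) = 0) ∧
    ∃ e : N, p = {C : Cond τ A |
      C.2.1.eval (Fin.snoc (α := fun _ => N) (fun i => c (C.2.2 i)) e) = 0}}

/-- `T` is `κ`-discrete stable: over every set of at most `κ` parameters in a model of `T` there
are at most `κ` complete `1`-types. -/
def DiscreteStable (T : Set (τ.Fml 0)) (κ : Cardinal.{u}) : Prop :=
  ∀ (M : Type u) [MetricSpace M] [CStructure τ M], CModels M T →
    ∀ A : Set M, #A ≤ κ → #(typeSpace τ A) ≤ κ

/-! ### The infinitary logic `L_{ω₁,ω}` -/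

/-- `L_{ω₁,ω}`-formulas of a discrete language in the free variables `x_0, …, x_{n-1}`. The
quantifiers bind the last variable `x_n` of a formula in `n + 1` variables. -/
inductive InfFml (L : FirstOrder.Language.{u, u}) : ℕ → Type (max 1 u)
  | verum {n : ℕ} : InfFml L n
  | falsum {n : ℕ} : InfFml L n
  | eq {n : ℕ} (s t : L.Term (Fin n)) : InfFml L n
  | rel {n k : ℕ} (R : L.Relations k) (ts : Fin k → L.Term (Fin n)) : InfFml L n
  | not {n : ℕ} (φ : InfFml L n) : InfFml L n
  | and {n : ℕ} (φ ψ : InfFml L n) : InfFml L n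
  | or {n : ℕ} (φ ψ : InfFml L n) : InfFml L n
  | imp {n : ℕ} (φ ψ : InfFml L n) : InfFml L n
  | conj {n : ℕ} (ι : Type) [Countable ι] (φ : ι → InfFml L n) : InfFml L n
  | disj {n : ℕ} (ι : Type) [Countable ι] (φ : ι → InfFml L n) : InfFml L n
  | all {n : ℕ} (φ : InfFml L (n + 1)) : InfFml L n
  | ex {n : ℕ} (φ : InfFml L (n + 1)) : InfFml L n

namespace InfFml

variable {L : FirstOrder.Language.{u, u}}

def iff {n : ℕ} (φ ψ : InfFml L n) : InfFml L n := and (imp φ ψ) (imp ψ φ)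

/-- Finite conjunction over `Fin k`. -/
def conjFin {n k : ℕ} (φ : Fin k → InfFml L n) : InfFml L n := conj (Fin k) φ

/-- Universal closure. -/
def closure : {n : ℕ} → InfFml L n → InfFml L 0
  | 0, φ => φ
  | _ + 1, φ => closure (all φ)

/-- Satisfaction. -/
def Realize {M : Type u} [L.Structure M] : {n : ℕ} → InfFml L n → (Fin n → M) → Prop
  | _, verum, _ => True
  | _, falsum, _ => False
  | _, eq s t, x => s.realize x = t.realize x
  | _, rel R ts, x => FirstOrder.Language.Structure.RelMap R fun i => (ts i).realize x
  | _, not φ, x => ¬ φ.Realize x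
  | _, and φ ψ, x => φ.Realize x ∧ ψ.Realize x
  | _, or φ ψ, x => φ.Realize x ∨ ψ.Realize x
  | _, imp φ ψ, x => φ.Realize x → ψ.Realize x
  | _, conj _ φ, x => ∀ i, (φ i).Realize x
  | _, disj _ φ, x => ∃ i, (φ i).Realize x
  | _, all φ, x => ∀ a : M, φ.Realize (Fin.snoc (α := fun _ => M) x a)
  | _, ex φ, x => ∃ a : M, φ.Realize (Fin.snoc (α := fun _ => M) x a)

end InfFml

/-! ### The discrete language `τ⁺` and the theories `T_dense`, `T*` -/

/-- `ℚ' = ℚ ∩ [0,1]`. -/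
abbrev QI : Type := Set.Icc (0 : ℚ) 1

/-- The relation symbols `R_{φ ≤ r}` and `R_{φ ≥ r}`, whose arity is the number of variables of
`φ`. -/
inductive PlusRel (τ : Lang.{u}) (n : ℕ) : Type u
  | le (φ : τ.Fml n) (r : QI) : PlusRel τ n
  | ge (φ : τ.Fml n) (r : QI) : PlusRel τ n

/-- The discrete language `τ⁺`. -/
def plus (τ : Lang.{u}) : FirstOrder.Language.{u, u} where
  Functions := τ.Functions
  Relations := PlusRel τ

/-- The inclusion of the function symbols into `τ⁺`, which turns `τ`-terms into `τ⁺`-terms. -/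
def toPlus (τ : Lang.{u}) : τ.funLang →ᴸ plus τ where
  onFunction := fun {_} f => f
  onRelation := fun {_} R => PEmpty.elim R

/-- `R_{φ ≤ q}(ts)` for a rational `q`; for `q` outside `[0,1]`, where there is no symbol, this
is the truth value of `v ≤ q` for `v ∈ [0,1]`. -/
def leAt {k n : ℕ} (φ : τ.Fml k) (q : ℚ) (ts : Fin k → (plus τ).Term (Fin n)) :
    InfFml (plus τ) n :=
  if h : q ∈ Set.Icc (0 : ℚ) 1 then .rel (L := plus τ) (PlusRel.le φ ⟨q, h⟩) ts
  else if q < 0 then .falsum else .verum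

/-- `R_{φ ≥ q}(ts)` for a rational `q`, with the same convention outside `[0,1]`. -/
def geAt {k n : ℕ} (φ : τ.Fml k) (q : ℚ) (ts : Fin k → (plus τ).Term (Fin n)) :
    InfFml (plus τ) n :=
  if h : q ∈ Set.Icc (0 : ℚ) 1 then .rel (L := plus τ) (PlusRel.ge φ ⟨q, h⟩) ts
  else if q < 0 then .verum else .falsum

/-- `R_{φ ≤ q}(x_0, …, x_{n-1})`. -/
def le {n : ℕ} (φ : τ.Fml n) (q : ℚ) : InfFml (plus τ) n := leAt φ q FirstOrder.Language.Term.var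

/-- `R_{φ ≥ q}(x_0, …, x_{n-1})`. -/
def ge {n : ℕ} (φ : τ.Fml n) (q : ℚ) : InfFml (plus τ) n := geAt φ q FirstOrder.Language.Term.var

/-- The variable `x_i` as a `τ⁺`-term. -/
abbrev pv {n : ℕ} (i : Fin n) : (plus τ).Term (Fin n) := FirstOrder.Language.Term.var i

/-- The formula `d(x_0, x_1)`. -/
def dFml (τ : Lang.{u}) : τ.Fml 2 := .dist (FirstOrder.Language.Term.var 0) (FirstOrder.Language.Term.var 1)

/-- The formula `R(x_0, …, x_{k-1}) ∸ R(x_k, …, x_{2k-1})`. -/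
def relDiff {k : ℕ} (R : τ.Relations k) : τ.Fml (k + k) :=
  .monus (.rel R fun i => FirstOrder.Language.Term.var (Fin.castAdd k i))
    (.rel R fun i => FirstOrder.Language.Term.var (Fin.natAdd k i))

open InfFml in
/-- The sentences of `T_dense`: the universal closures of the following formulas. -/
inductive IsDense (τ : Lang.{u}) : InfFml (plus τ) 0 → Prop
  -- the ordered structure of the reals
  | not_ge {n : ℕ} (φ : τ.Fml n) (r : QI) :
      IsDense τ (closure (imp (not (ge φ r)) (le φ r)))
  | not_le {n : ℕ} (φ : τ.Fml n) (r : QI) :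
      IsDense τ (closure (imp (not (le φ r)) (ge φ r)))
  | not_both {n : ℕ} (φ : τ.Fml n) (r s : QI) (h : s < r) :
      IsDense τ (closure (or (not (ge φ r)) (not (le φ s))))
  | le_mono {n : ℕ} (φ : τ.Fml n) (r s : QI) (h : s ≤ r) :
      IsDense τ (closure (imp (le φ s) (le φ r)))
  | ge_mono {n : ℕ} (φ : τ.Fml n) (r s : QI) (h : s ≤ r) :
      IsDense τ (closure (imp (ge φ r) (ge φ s)))
  | total {n : ℕ} (φ : τ.Fml n) (r : QI) :
      IsDense τ (closure (or (ge φ r) (le φ r)))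
  | value {n : ℕ} (φ : τ.Fml n) :
      IsDense τ (closure (conj ℕ fun m =>
        disj {p : QI × QI // |(p.1 : ℚ) - p.2| < 1 / (m + 1)} fun p =>
          and (le φ p.1.1) (ge φ p.1.2)))
  | ge_closed {n : ℕ} (φ : τ.Fml n) (r : QI) :
      IsDense τ (closure (imp (conj ℕ fun m => ge φ (r - 1 / (m + 1))) (ge φ r)))
  | le_closed {n : ℕ} (φ : τ.Fml n) (r : QI) :
      IsDense τ (closure (imp (conj ℕ fun m => le φ (r + 1 / (m + 1))) (le φ r)))
  -- construction of formulas
  | bounds {n : ℕ} (φ : τ.Fml n) :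
      IsDense τ (closure (and (ge φ 0) (le φ 1)))
  | zero_one {n : ℕ} (t : QI) (h : 0 < t) :
      IsDense τ (closure (n := n) (and (not (ge .zero t)) (not (le .one (1 - t)))))
  | half_ge {n : ℕ} (φ : τ.Fml n) (r : QI) :
      IsDense τ (closure (iff (ge (.half φ) r) (ge φ (2 * r))))
  | half_le {n : ℕ} (φ : τ.Fml n) (r : QI) :
      IsDense τ (closure (iff (le (.half φ) r) (le φ (2 * r))))
  | monus_ge {n : ℕ} (φ ψ : τ.Fml n) (r : QI) (h : 0 < r) :
      IsDense τ (closure (iff (ge (.monus φ ψ) r)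
        (conj ℕ fun m => disj QI fun s => and (le ψ s) (ge φ (r + s - 1 / (m + 1))))))
  | monus_le {n : ℕ} (φ ψ : τ.Fml n) (r : QI) :
      IsDense τ (closure (iff (le (.monus φ ψ) r)
        (conj ℕ fun m => disj QI fun s => and (ge ψ s) (le φ (r + s + 1 / (m + 1))))))
  | sup_le {n : ℕ} (φ : τ.Fml (n + 1)) (r : QI) :
      IsDense τ (closure (iff (le (.sup φ) r) (all (le φ r))))
  | sup_ge {n : ℕ} (φ : τ.Fml (n + 1)) (r : QI) :
      IsDense τ (closure (iff (ge (.sup φ) r) (conj ℕ fun m => ex (ge φ (r - 1 / (m + 1))))))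
  | inf_le {n : ℕ} (φ : τ.Fml (n + 1)) (r : QI) :
      IsDense τ (closure (iff (le (.inf φ) r) (conj ℕ fun m => ex (le φ (r + 1 / (m + 1))))))
  | inf_ge {n : ℕ} (φ : τ.Fml (n + 1)) (r : QI) :
      IsDense τ (closure (iff (ge (.inf φ) r) (all (ge φ r))))
  | subst_le {n k : ℕ} (φ : τ.Fml k) (ts : Fin k → τ.Term n) (r : QI) :
      IsDense τ (closure (iff (leAt φ r fun i => (toPlus τ).onTerm (ts i)) (le (φ.subst ts) r)))
  | subst_ge {n k : ℕ} (φ : τ.Fml k) (ts : Fin k → τ.Term n) (r : QI) :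
      IsDense τ (closure (iff (geAt φ r fun i => (toPlus τ).onTerm (ts i)) (ge (φ.subst ts) r)))
  -- metric structure
  | dist_zero :
      IsDense τ (closure (n := 2) (iff (leAt (dFml τ) 0 ![pv 0, pv 1]) (eq (pv 0) (pv 1))))
  | dist_symm_le (r : QI) :
      IsDense τ (closure (n := 2)
        (iff (leAt (dFml τ) r ![pv 0, pv 1]) (leAt (dFml τ) r ![pv 1, pv 0])))
  | dist_symm_ge (r : QI) :
      IsDense τ (closure (n := 2)
        (iff (geAt (dFml τ) r ![pv 0, pv 1]) (geAt (dFml τ) r ![pv 1, pv 0])))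
  | dist_triangle :
      IsDense τ (closure (n := 2) (conj QI fun r =>
        imp (geAt (dFml τ) r ![pv 0, pv 1])
          (all (conj ℕ fun m => disj {s : QI // s ≤ r} fun s =>
            and (geAt (dFml τ) s.1 ![pv 0, pv 2])
              (geAt (dFml τ) (r - s.1 - 1 / (m + 1)) ![pv 2, pv 1])))))
  -- uniform continuity; the first `k` variables are `x`, the last `k` are `y`
  | fun_unif {k : ℕ} (f : τ.Functions k) (ε : ℝ) (hε : ε ∈ Set.Ioc (0 : ℝ) 1) (r s : QI)
      (hr : ε ≤ ((r : ℚ) : ℝ)) (hs : ((s : ℚ) : ℝ) < τ.funMod f ε) :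
      IsDense τ (closure (n := k + k)
        (imp (conjFin fun i : Fin k =>
            leAt (dFml τ) s ![pv (Fin.castAdd k i), pv (Fin.natAdd k i)])
          (leAt (dFml τ) r
            ![FirstOrder.Language.Term.func (L := plus τ) f fun i => pv (Fin.castAdd k i),
              FirstOrder.Language.Term.func (L := plus τ) f fun i => pv (Fin.natAdd k i)])))
  | rel_unif {k : ℕ} (R : τ.Relations k) (ε : ℝ) (hε : ε ∈ Set.Ioc (0 : ℝ) 1) (r s : QI)
      (hr : ε ≤ ((r : ℚ) : ℝ)) (hs : ((s : ℚ) : ℝ) < τ.relMod R ε) :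
      IsDense τ (closure (n := k + k)
        (imp (conjFin fun i : Fin k =>
            leAt (dFml τ) s ![pv (Fin.castAdd k i), pv (Fin.natAdd k i)])
          (and (leAt (relDiff R) r (Fin.append (fun i => pv (Fin.castAdd k i))
              (fun i => pv (Fin.natAdd k i))))
            (leAt (relDiff R) r (Fin.append (fun i => pv (Fin.natAdd k i))
              (fun i => pv (Fin.castAdd k i)))))))

/-- The `L_{ω₁,ω}(τ⁺)`-theory `T_dense`. -/
def Tdense (τ : Lang.{u}) : Set (InfFml (plus τ) 0) := {σ | IsDense τ σ}

/-- The `L_{ω₁,ω}(τ⁺)`-theory `T* = T_dense ∪ {R_{φ ≤ 0} : (φ = 0) ∈ T}`. -/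
def Tstar (T : Set (τ.Fml 0)) : Set (InfFml (plus τ) 0) :=
  Tdense τ ∪ (fun φ => le φ 0) '' T

/-! ### Galois types and Galois stability -/

/-- A class of `L`-structures. -/
abbrev StrClass (L : FirstOrder.Language.{u, u}) : Type (u + 1) := ∀ M : Type u, L.Structure M → Prop

/-- The class of (nonempty) models of an `L_{ω₁,ω}`-theory. -/
def Mod {L : FirstOrder.Language.{u, u}} (S : Set (InfFml L 0)) : StrClass L :=
  fun M _ => Nonempty M ∧ ∀ σ ∈ S, σ.Realize (M := M) Fin.elim0

/-- For the class `(K, ⊂_L)`, in which the strong substructure relation is the substructure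
relation: an extension `N ∈ K` of `M`, given by an `L`-embedding `M → N`, with an element
`a ∈ N`. -/
structure PointedExt {L : FirstOrder.Language.{u, u}} (K : StrClass L) (M : Type u) [L.Structure M] where
  N : Type u
  [str : L.Structure N]
  mem : K N str
  emb : M ↪[L] N
  a : N

attribute [instance] PointedExt.str

/-- Two pointed extensions of `M` are atomically equivalent if some `N ∈ K` amalgamates them over
`M` and identifies the two points. -/
def AtEquiv {L : FirstOrder.Language.{u, u}} (K : StrClass L) {M : Type u} [L.Structure M]
    (p q : PointedExt K M) : Prop :=
  ∃ (N : Type u) (str : L.Structure N), K N str ∧ ∃ (f : p.N ↪[L] N) (g : q.N ↪[L] N),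
    (∀ m : M, f (p.emb m) = g (q.emb m)) ∧ f p.a = g q.a

/-- Galois types over `M` of single elements: pointed extensions modulo the equivalence relation
generated by atomic equivalence. -/
def GaloisType {L : FirstOrder.Language.{u, u}} (K : StrClass L) (M : Type u) [L.Structure M] :
    Type (u + 1) :=
  Quot (AtEquiv K (M := M))

/-- `(K, ⊂_L)` is `κ`-Galois stable: there are at most `κ` Galois types over every `M ∈ K` of
cardinality `κ`. -/
def GaloisStable {L : FirstOrder.Language.{u, u}} (K : StrClass L) (κ : Cardinal.{u}) : Prop :=
  ∀ (M : Type u) [str : L.Structure M], K M str → #M = κ →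
    #(GaloisType K M) ≤ Cardinal.lift.{u + 1} κ

end ContLogic

/-! A nonempty model of $T^*$ is a continuous structure in disguise. The order axioms turn the
rationals $q$ with $R_{\phi\ge q}(\mathbf x)$ into a cut, which defines a value of $\phi$ at
$\mathbf x$. The remaining axioms say that these values obey the clauses of continuous semantics,
with a metric and the prescribed moduli. Hence models of $T^*$ are the same as prestructures on
metric spaces, complete or not, in which the conditions of $T$ hold (`exists_isPlus`,
`IsPlus.mod_Tstar_iff`). Every formula is now coded by relation symbols, so $\tau^+$-embeddings are
exactly the maps that preserve the values of all formulas (`IsPlus.isElem_embedding`,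
`IsElem.embedding`).

Consequently a Galois type over $D$ is a set of conditions $\phi=0$ over $D$. Amalgamation preserves
this set (`AtEquiv.condSet_eq`). Conversely, points with equal sets can be identified
(`atEquiv_of_condSet_eq`) by the compactness result `exists_joint_extension`: approximate values of
finitely many formulas are expressed by one formula, an infimum over the elements outside the base
carries it from one structure to the other, and the approximations become exact in a completed
ultrapower.

If $T$ is discrete stable and $|D|=\lambda$, then $D$ is a set of $\lambda$ parameters in its
completion, and Galois types over $D$ inject into the types over that set. Conversely, given
$A\subseteq M$, all types over $A$ are realized in a single structure $Q$. Either $|Q|\le\lambda$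
and there is nothing to count, or Löwenheim–Skolem gives an elementary $D\subseteq Q$ of size
exactly $\lambda$ that contains $A$, and different types over $A$ yield different Galois types over
$D$. Here $D$ must be allowed to be incomplete, because its completion may have more than $\lambda$
points; this is why prestructures are used throughout. -/

namespace ContLogic

/-- Prestructures: as `CStructure`, but on a pseudometric space that need not be complete. -/
class PreStructure (τ : Lang.{u}) (M : Type u) [PseudoMetricSpace M] where
  nonempty : Nonempty M
  dist_le_one : ∀ x y : M, dist x y ≤ 1
  funMap : ∀ {n : ℕ}, τ.Functions n → (Fin n → M) → M
  relMap : ∀ {n : ℕ}, τ.Relations n → (Fin n → M) → ℝ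
  relMap_mem : ∀ {n : ℕ} (R : τ.Relations n) (x : Fin n → M), relMap R x ∈ Set.Icc (0 : ℝ) 1
  funMap_unif : ∀ {n : ℕ} (f : τ.Functions n) (ε : ℝ), ε ∈ Set.Ioc (0 : ℝ) 1 →
    ∀ x y : Fin n → M, (∀ i, dist (x i) (y i) < τ.funMod f ε) →
      dist (funMap f x) (funMap f y) ≤ ε
  relMap_unif : ∀ {n : ℕ} (R : τ.Relations n) (ε : ℝ), ε ∈ Set.Ioc (0 : ℝ) 1 →
    ∀ x y : Fin n → M, (∀ i, dist (x i) (y i) < τ.relMod R ε) →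
      |relMap R x - relMap R y| ≤ ε

variable {τ : Lang.{u}}

/-! ### Semantics and uniform continuity in prestructures -/

section Eval

variable {M : Type u} [PseudoMetricSpace M] [PreStructure τ M]

/-- The value of a term in a prestructure. -/
def tval {n : ℕ} (x : Fin n → M) : τ.Term n → M
  | .var i => x i
  | .func f ts => PreStructure.funMap (τ := τ) f fun i => tval x (ts i)

/-- The value of a formula in a prestructure. -/
noncomputable def peval : {n : ℕ} → τ.Fml n → (Fin n → M) → ℝ
  | _, .rel R ts, x => PreStructure.relMap R fun i => tval x (ts i)
  | _, .dist s t, x => Dist.dist (tval x s) (tval x t)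
  | _, .zero, _ => 0
  | _, .one, _ => 1
  | _, .half φ, x => peval φ x / 2
  | _, .monus φ ψ, x => max (peval φ x - peval ψ x) 0
  | _, .sup φ, x => ⨆ a : M, peval φ (Fin.snoc (α := fun _ => M) x a)
  | _, .inf φ, x => ⨅ a : M, peval φ (Fin.snoc (α := fun _ => M) x a)

theorem peval_mem {n : ℕ} (φ : τ.Fml n) (x : Fin n → M) : peval φ x ∈ Set.Icc (0 : ℝ) 1 := by
  have : Nonempty M := PreStructure.nonempty τ
  induction φ with
  | rel R ts => exact PreStructure.relMap_mem R _
  | dist s t => exact ⟨dist_nonneg, PreStructure.dist_le_one τ _ _⟩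
  | zero => simp [peval]
  | one => simp [peval]
  | half φ ih =>
    obtain ⟨h0, h1⟩ := ih x
    exact ⟨by simp only [peval]; linarith, by simp only [peval]; linarith⟩
  | monus φ ψ ihφ ihψ =>
    obtain ⟨h0, h1⟩ := ihφ x
    obtain ⟨h2, h3⟩ := ihψ x
    exact ⟨le_max_right _ _, max_le (by linarith) zero_le_one⟩
  | sup φ ih =>
    exact ⟨Real.iSup_nonneg fun a => (ih _).1, ciSup_le fun a => (ih _).2⟩
  | inf φ ih =>
    refine ⟨Real.iInf_nonneg fun a => (ih _).1, ?_⟩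
    exact (ciInf_le ⟨0, by rintro _ ⟨a, rfl⟩; exact (ih _).1⟩ (Classical.arbitrary M)).trans
      (ih _).2

/-- The real `⨆` is a true supremum only for nonempty bounded families; nonemptiness of the
structure and `peval_mem` supply both. -/
theorem isLUB_peval_sup {n : ℕ} (φ : τ.Fml (n + 1)) (x : Fin n → M) :
    IsLUB (Set.range fun a : M => peval φ (Fin.snoc (α := fun _ => M) x a))
      (peval (.sup φ) x) := by
  have : Nonempty M := PreStructure.nonempty τ
  exact isLUB_ciSup ⟨1, by rintro _ ⟨a, rfl⟩; exact (peval_mem _ _).2⟩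

theorem isGLB_peval_inf {n : ℕ} (φ : τ.Fml (n + 1)) (x : Fin n → M) :
    IsGLB (Set.range fun a : M => peval φ (Fin.snoc (α := fun _ => M) x a))
      (peval (.inf φ) x) := by
  have : Nonempty M := PreStructure.nonempty τ
  exact isGLB_ciInf ⟨0, by rintro _ ⟨a, rfl⟩; exact (peval_mem _ _).1⟩

theorem peval_le_sup {n : ℕ} (φ : τ.Fml (n + 1)) (x : Fin n → M) (a : M) :
    peval φ (Fin.snoc (α := fun _ => M) x a) ≤ peval (.sup φ) x :=
  (isLUB_peval_sup φ x).1 ⟨a, rfl⟩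

theorem peval_inf_le {n : ℕ} (φ : τ.Fml (n + 1)) (x : Fin n → M) (a : M) :
    peval (.inf φ) x ≤ peval φ (Fin.snoc (α := fun _ => M) x a) :=
  (isGLB_peval_inf φ x).1 ⟨a, rfl⟩

theorem peval_sup_le_iff {n : ℕ} (φ : τ.Fml (n + 1)) (x : Fin n → M) (r : ℝ) :
    peval (.sup φ) x ≤ r ↔ ∀ a : M, peval φ (Fin.snoc (α := fun _ => M) x a) ≤ r := by
  rw [isLUB_le_iff (isLUB_peval_sup φ x)]
  simp [upperBounds]

theorem le_peval_inf_iff {n : ℕ} (φ : τ.Fml (n + 1)) (x : Fin n → M) (r : ℝ) :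
    r ≤ peval (.inf φ) x ↔ ∀ a : M, r ≤ peval φ (Fin.snoc (α := fun _ => M) x a) := by
  rw [le_isGLB_iff (isGLB_peval_inf φ x)]
  simp [lowerBounds]

theorem exists_lt_of_lt_peval_sup {n : ℕ} {φ : τ.Fml (n + 1)} {x : Fin n → M} {r : ℝ}
    (h : r < peval (.sup φ) x) : ∃ a : M, r < peval φ (Fin.snoc (α := fun _ => M) x a) := by
  by_contra! hc
  exact absurd h (not_lt.2 ((peval_sup_le_iff φ x r).2 hc))

theorem exists_lt_of_peval_inf_lt {n : ℕ} {φ : τ.Fml (n + 1)} {x : Fin n → M} {r : ℝ}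
    (h : peval (.inf φ) x < r) : ∃ a : M, peval φ (Fin.snoc (α := fun _ => M) x a) < r := by
  by_contra! hc
  exact absurd h (not_lt.2 ((le_peval_inf_iff φ x r).2 hc))

theorem exists_delta_fun {n : ℕ} (f : τ.Functions n) {ε : ℝ} (hε : 0 < ε) :
    ∃ δ > 0, ∀ x y : Fin n → M, (∀ i, dist (x i) (y i) < δ) →
      dist (PreStructure.funMap (τ := τ) f x) (PreStructure.funMap (τ := τ) f y) ≤ ε := by
  -- The moduli are constrained only on $(0,1]$, so a large $\varepsilon$ is cut down to $1$.
  have h : min ε 1 ∈ Set.Ioc (0 : ℝ) 1 := ⟨lt_min hε one_pos, min_le_right _ _⟩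
  exact ⟨τ.funMod f (min ε 1), (τ.funMod_mem f _ h).1, fun x y hxy =>
    (PreStructure.funMap_unif f _ h x y hxy).trans (min_le_left _ _)⟩

theorem exists_delta_rel {n : ℕ} (R : τ.Relations n) {ε : ℝ} (hε : 0 < ε) :
    ∃ δ > 0, ∀ x y : Fin n → M, (∀ i, dist (x i) (y i) < δ) →
      |PreStructure.relMap (τ := τ) R x - PreStructure.relMap (τ := τ) R y| ≤ ε := by
  have h : min ε 1 ∈ Set.Ioc (0 : ℝ) 1 := ⟨lt_min hε one_pos, min_le_right _ _⟩
  exact ⟨τ.relMod R (min ε 1), (τ.relMod_mem R _ h).1, fun x y hxy =>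
    (PreStructure.relMap_unif R _ h x y hxy).trans (min_le_left _ _)⟩

theorem exists_common_delta {k : ℕ} {p : Fin k → ℝ → Prop} (h : ∀ i, ∃ δ > 0, p i δ)
    (hp : ∀ i a b, a ≤ b → p i b → p i a) : ∃ δ > 0, ∀ i, p i δ := by
  choose δ h0 h1 using h
  obtain ⟨d, hd0, hd⟩ : ∃ d > 0, ∀ i, d ≤ δ i := by
    -- The smallest `δ i` works; for arity $0$ there is none, and any positive number will do.
    rcases Nat.eq_zero_or_pos k with rfl | hk
    · exact ⟨1, one_pos, fun i => i.elim0⟩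
    · have : Nonempty (Fin k) := ⟨⟨0, hk⟩⟩
      obtain ⟨j, hj⟩ := Finite.exists_min δ
      exact ⟨δ j, h0 j, hj⟩
  exact ⟨d, hd0, fun i => hp i _ _ (hd i) (h1 i)⟩

theorem exists_delta_tval {n : ℕ} (t : τ.Term n) {ε : ℝ} (hε : 0 < ε) :
    ∃ δ > 0, ∀ x y : Fin n → M, (∀ i, dist (x i) (y i) < δ) →
      dist (tval x t) (tval y t) < ε := by
  induction t generalizing ε with
  | var i => exact ⟨ε, hε, fun x y h => h i⟩
  | func f ts ih =>
    obtain ⟨δ, hδ, h⟩ := exists_delta_fun (M := M) (τ := τ) f (half_pos hε)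
    obtain ⟨d, hd, h'⟩ := exists_common_delta (fun i => ih i hδ)
      (fun i a b hab hb x y hxy => hb x y fun j => (hxy j).trans_le hab)
    exact ⟨d, hd, fun x y hxy => (h _ _ fun i => h' i x y hxy).trans_lt (half_lt_self hε)⟩

/-- Formulas are uniformly continuous. -/
theorem exists_delta_peval {n : ℕ} (φ : τ.Fml n) {ε : ℝ} (hε : 0 < ε) :
    ∃ δ > 0, ∀ x y : Fin n → M, (∀ i, dist (x i) (y i) < δ) →
      |peval φ x - peval φ y| ≤ ε := by
  -- Both tuples are extended by the same element, so the `δ` for `φ` also serves `sup φ` and `inf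
  -- φ`, uniformly in that element.
  have snoc_lt : ∀ {n : ℕ} {δ : ℝ} (_ : 0 < δ) {x y : Fin n → M}
      (_ : ∀ i, dist (x i) (y i) < δ) (a : M) (i : Fin (n + 1)),
      dist (Fin.snoc (α := fun _ => M) x a i) (Fin.snoc (α := fun _ => M) y a i) < δ := by
    intro n δ hδ x y h a i
    refine Fin.lastCases ?_ (fun j => ?_) i
    · simpa using hδ
    · simpa using h j
  induction φ generalizing ε with
  | rel R ts =>
    obtain ⟨δ, hδ, h⟩ := exists_delta_rel (M := M) (τ := τ) R hε
    obtain ⟨d, hd, h'⟩ := exists_common_delta (fun i => exists_delta_tval (M := M) (ts i) hδ)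
      (fun i a b hab hb x y hxy => hb x y fun j => (hxy j).trans_le hab)
    exact ⟨d, hd, fun x y hxy => h _ _ fun i => h' i x y hxy⟩
  | dist s t =>
    obtain ⟨d, hd, h⟩ := exists_delta_tval (M := M) s (half_pos hε)
    obtain ⟨d', hd', h'⟩ := exists_delta_tval (M := M) t (half_pos hε)
    refine ⟨min d d', lt_min hd hd', fun x y hxy => ?_⟩
    have h1 := h x y fun i => (hxy i).trans_le (min_le_left _ _)
    have h2 := h' x y fun i => (hxy i).trans_le (min_le_right _ _)
    have h3 := dist_dist_dist_le (tval x s) (tval x t) (tval y s) (tval y t)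
    rw [Real.dist_eq] at h3
    simp only [peval]
    linarith
  | zero => exact ⟨1, one_pos, fun x y _ => by simpa [peval] using hε.le⟩
  | one => exact ⟨1, one_pos, fun x y _ => by simpa [peval] using hε.le⟩
  | half φ ih =>
    obtain ⟨d, hd, h⟩ := ih hε
    refine ⟨d, hd, fun x y hxy => ?_⟩
    have h1 := abs_le.1 (h x y hxy)
    simp only [peval]
    rw [abs_le]
    constructor <;> linarith
  | monus φ ψ ih ih' =>
    obtain ⟨d, hd, h⟩ := ih (half_pos hε)
    obtain ⟨d', hd', h'⟩ := ih' (half_pos hε)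
    refine ⟨min d d', lt_min hd hd', fun x y hxy => ?_⟩
    have h1 := abs_le.1 (h x y fun i => (hxy i).trans_le (min_le_left _ _))
    have h2 := abs_le.1 (h' x y fun i => (hxy i).trans_le (min_le_right _ _))
    refine (abs_max_sub_max_le_abs _ _ _).trans (abs_le.2 ?_)
    constructor <;> linarith
  | sup φ ih =>
    obtain ⟨d, hd, h⟩ := ih hε
    refine ⟨d, hd, fun x y hxy => ?_⟩
    have key : ∀ a, _ := fun a => abs_le.1 (h _ _ (snoc_lt hd hxy a))
    rw [abs_sub_le_iff, sub_le_iff_le_add, sub_le_iff_le_add, peval_sup_le_iff, peval_sup_le_iff]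
    exact ⟨fun a => by linarith [key a, peval_le_sup φ y a],
      fun a => by linarith [key a, peval_le_sup φ x a]⟩
  | inf φ ih =>
    obtain ⟨d, hd, h⟩ := ih hε
    refine ⟨d, hd, fun x y hxy => ?_⟩
    have key : ∀ a, _ := fun a => abs_le.1 (h _ _ (snoc_lt hd hxy a))
    rw [abs_sub_le_iff, sub_le_comm, sub_le_comm (b := peval _ x), le_peval_inf_iff,
      le_peval_inf_iff]
    exact ⟨fun a => by linarith [key a, peval_inf_le φ x a],
      fun a => by linarith [key a, peval_inf_le φ y a]⟩

theorem tval_relabel {n m : ℕ} (t : τ.Term n) (g : Fin n → Fin m) (x : Fin m → M) :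
    tval x (t.relabel g) = tval (x ∘ g) t := by
  induction t with
  | var i => rfl
  | func f ts ih => exact congrArg _ (funext ih)

theorem tval_subst {n m : ℕ} (t : τ.Term n) (ts : Fin n → τ.Term m) (x : Fin m → M) :
    tval x (t.subst ts) = tval (fun i => tval x (ts i)) t := by
  induction t with
  | var i => rfl
  | func f us ih => exact congrArg _ (funext ih)

theorem tval_liftSubst {n m : ℕ} (ts : Fin n → τ.Term m) (x : Fin m → M) (a : M) :
    (fun i => tval (Fin.snoc (α := fun _ => M) x a) (liftSubst ts i)) =
      Fin.snoc (α := fun _ => M) (fun i => tval x (ts i)) a := by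
  funext i
  refine Fin.lastCases ?_ (fun j => ?_) i
  · simp [liftSubst, tval]
  · have : (Fin.snoc (α := fun _ => M) x a) ∘ Fin.castSucc = x := by
      funext j; simp
    simp [liftSubst, tval_relabel, this]

theorem peval_subst {n m : ℕ} (φ : τ.Fml n) (ts : Fin n → τ.Term m) (x : Fin m → M) :
    peval (φ.subst ts) x = peval φ fun i => tval x (ts i) := by
  induction φ generalizing m with
  | rel R us => simp only [Lang.Fml.subst, peval, tval_subst]
  | dist s t => simp only [Lang.Fml.subst, peval, tval_subst]
  | zero => rfl
  | one => rfl
  | half φ ih => simp only [Lang.Fml.subst, peval, ih]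
  | monus φ ψ ih ih' => simp only [Lang.Fml.subst, peval, ih, ih']
  | sup φ ih => simp only [Lang.Fml.subst, peval, ih, tval_liftSubst]
  | inf φ ih => simp only [Lang.Fml.subst, peval, ih, tval_liftSubst]

end Eval

/-! ### Elementary maps -/

section Elementary

variable {M N : Type u} [PseudoMetricSpace M] [PreStructure τ M] [PseudoMetricSpace N]
  [PreStructure τ N]

/-- Maps that preserve the values of all formulas. -/
def IsElem (τ : Lang.{u}) {M N : Type u} [PseudoMetricSpace M] [PreStructure τ M]
    [PseudoMetricSpace N] [PreStructure τ N] (f : M → N) : Prop :=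
  ∀ (n : ℕ) (φ : τ.Fml n) (x : Fin n → M), peval φ (fun i => f (x i)) = peval φ x

theorem comp_snoc_eq {M N : Type u} {n : ℕ} (f : M → N) (x : Fin n → M) (a : M) :
    (fun i => f (Fin.snoc (α := fun _ => M) x a i)) =
      Fin.snoc (α := fun _ => N) (fun i => f (x i)) (f a) := by
  funext i
  refine Fin.lastCases ?_ (fun j => ?_) i <;> simp

theorem tval_comp {f : M → N}
    (hfun : ∀ (n : ℕ) (F : τ.Functions n) (x : Fin n → M),
      f (PreStructure.funMap F x) = PreStructure.funMap F fun i => f (x i))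
    {n : ℕ} (t : τ.Term n) (x : Fin n → M) : tval (fun i => f (x i)) t = f (tval x t) := by
  induction t with
  | var i => rfl
  | func F ts ih => exact (congrArg _ (funext ih)).trans (hfun _ _ _).symm

/-- The Tarski–Vaught test. -/
theorem isElem_of_approx {f : M → N}
    (hfun : ∀ (n : ℕ) (F : τ.Functions n) (x : Fin n → M),
      f (PreStructure.funMap F x) = PreStructure.funMap F fun i => f (x i))
    (hrel : ∀ (n : ℕ) (R : τ.Relations n) (x : Fin n → M),
      PreStructure.relMap R (fun i => f (x i)) = PreStructure.relMap R x)
    (hdist : ∀ x y, dist (f x) (f y) = dist x y)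
    (h : ∀ (n : ℕ) (φ : τ.Fml (n + 1)) (x : Fin n → M) (a : N) (ε : ℝ), 0 < ε → ∃ b : M,
      |peval φ (Fin.snoc (α := fun _ => N) (fun i => f (x i)) (f b)) -
        peval φ (Fin.snoc (α := fun _ => N) (fun i => f (x i)) a)| ≤ ε) :
    IsElem τ f := by
  intro n φ x
  induction φ with
  | rel R ts => simp only [peval, tval_comp hfun, hrel]
  | dist s t => simp only [peval, tval_comp hfun, hdist]
  | zero => rfl
  | one => rfl
  | half φ ih => simp only [peval, ih]
  | monus φ ψ ih ih' => simp only [peval, ih, ih']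
  | sup φ ih =>
    have key : ∀ b, _ := fun b => ih (Fin.snoc (α := fun _ => M) x b)
    simp only [comp_snoc_eq] at key
    apply le_antisymm
    -- The supremum over `N` might exceed the one over `f(M)`; each value at `a` is within `ε` of a
    -- value at some `f b`, which the supremum over `M` bounds.
    · refine (peval_sup_le_iff _ _ _).2 fun a => le_of_forall_pos_le_add fun ε hε => ?_
      obtain ⟨b, hb⟩ := h _ φ x a ε hε
      have := abs_le.1 hb
      linarith [key b, peval_le_sup φ x b]
    · refine (peval_sup_le_iff _ _ _).2 fun b => ?_
      rw [← key b]
      exact peval_le_sup φ _ _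
  | inf φ ih =>
    have key : ∀ b, _ := fun b => ih (Fin.snoc (α := fun _ => M) x b)
    simp only [comp_snoc_eq] at key
    apply le_antisymm
    · refine (le_peval_inf_iff _ _ _).2 fun b => ?_
      rw [← key b]
      exact peval_inf_le φ _ _
    · refine (le_peval_inf_iff _ _ _).2 fun a => le_of_forall_pos_le_add fun ε hε => ?_
      obtain ⟨b, hb⟩ := h _ φ x a ε hε
      have := abs_le.1 hb
      linarith [key b, peval_inf_le φ x b]

/-- By uniform continuity of `φ`, any `f b` close enough to `a` is the approximation required by
`isElem_of_approx`. -/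
theorem isElem_of_denseRange {f : M → N} (hd : DenseRange f)
    (hfun : ∀ (n : ℕ) (F : τ.Functions n) (x : Fin n → M),
      f (PreStructure.funMap F x) = PreStructure.funMap F fun i => f (x i))
    (hrel : ∀ (n : ℕ) (R : τ.Relations n) (x : Fin n → M),
      PreStructure.relMap R (fun i => f (x i)) = PreStructure.relMap R x)
    (hdist : ∀ x y, dist (f x) (f y) = dist x y) : IsElem τ f := by
  refine isElem_of_approx hfun hrel hdist fun n φ x a ε hε => ?_
  obtain ⟨δ, hδ, h⟩ := exists_delta_peval (M := N) φ hε
  obtain ⟨b, hb⟩ := hd.exists_dist_lt a hδ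
  refine ⟨b, h _ _ fun i => ?_⟩
  refine Fin.lastCases ?_ (fun j => ?_) i
  · simpa [dist_comm] using hb
  · simpa using hδ

theorem IsElem.comp {P : Type u} [PseudoMetricSpace P] [PreStructure τ P] {f : M → N}
    {g : N → P} (hg : IsElem τ g) (hf : IsElem τ f) : IsElem τ fun a => g (f a) :=
  fun n φ x => (hg n φ fun i => f (x i)).trans (hf n φ x)

theorem IsElem.peval_snoc {f : M → N} (hf : IsElem τ f) {n : ℕ} (φ : τ.Fml (n + 1))
    (x : Fin n → M) (a : M) :
    peval φ (Fin.snoc (α := fun _ => N) (fun i => f (x i)) (f a)) =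
      peval φ (Fin.snoc (α := fun _ => M) x a) := by
  rw [← comp_snoc_eq, hf]

theorem IsElem.dist_eq {f : M → N} (hf : IsElem τ f) (x y : M) :
    dist (f x) (f y) = dist x y := by
  simpa [dFml, peval, tval] using hf 2 (dFml τ) ![x, y]

end Elementary

open UniformSpace

/-! ### Complete structures as prestructures -/

section OfCStructure

instance CStructure.toPreStructure {M : Type u} [MetricSpace M] [h : CStructure τ M] :
    PreStructure τ M where
  nonempty := h.nonempty
  dist_le_one := h.dist_le_one
  funMap := h.funMap
  relMap := h.relMap
  relMap_mem := h.relMap_mem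
  funMap_unif := h.funMap_unif
  relMap_unif := h.relMap_unif

variable {M : Type u} [MetricSpace M] [CStructure τ M]

theorem tval_eq_realize {n : ℕ} (t : τ.Term n) (x : Fin n → M) : tval x t = t.realize x := by
  induction t with
  | var i => rfl
  | func f ts ih => exact congrArg _ (funext ih)

theorem peval_eq_eval {n : ℕ} (φ : τ.Fml n) (x : Fin n → M) : peval φ x = φ.eval x := by
  induction φ with
  | rel R us => simp only [Lang.Fml.eval, peval, tval_eq_realize]; rfl
  | dist s t => simp only [Lang.Fml.eval, peval, tval_eq_realize]
  | zero => rfl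
  | one => rfl
  | half φ ih => simp only [Lang.Fml.eval, peval, ih]
  | monus φ ψ ih ih' => simp only [Lang.Fml.eval, peval, ih, ih']
  | sup φ ih => simp only [Lang.Fml.eval, peval, ih]
  | inf φ ih => simp only [Lang.Fml.eval, peval, ih]

end OfCStructure

/-! ### Completion of a prestructure -/

section Completion

/-- This carries the moduli to the completion unchanged: distances below $\Delta(\varepsilon)$ form
an open condition, and the conclusion $\le\varepsilon$ is a closed one. -/
theorem DenseRange.subset_of_isOpen_of_isClosed {X Y : Type*} [TopologicalSpace Y] {e : X → Y}
    (he : DenseRange e) {U C : Set Y} (hU : IsOpen U) (hC : IsClosed C)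
    (h : ∀ x, e x ∈ U → e x ∈ C) : U ⊆ C := by
  refine (he.open_subset_closure_inter hU).trans (hC.closure_subset_iff.2 ?_)
  rintro _ ⟨hy, x, rfl⟩
  exact h x hy

variable {M : Type u} [PseudoMetricSpace M]

/-- The coordinatewise inclusion of tuples into the completion. -/
def coePi (M : Type u) [PseudoMetricSpace M] (n : ℕ) : (Fin n → M) → Fin n → Completion M :=
  fun x i => (x i : Completion M)

theorem isUniformInducing_coePi (n : ℕ) : IsUniformInducing (coePi M n) := by
  refine Isometry.isUniformInducing fun x y => ?_
  simp only [edist_pi_def, coePi, Completion.edist_eq]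

theorem denseRange_coePi (n : ℕ) : DenseRange (coePi M n) :=
  DenseRange.piMap (f := fun _ : Fin n => ((↑) : M → Completion M))
    fun _ => Completion.denseRange_coe

variable [PreStructure τ M]

theorem uniformContinuous_funMap {n : ℕ} (f : τ.Functions n) :
    UniformContinuous (PreStructure.funMap (τ := τ) (M := M) f) := by
  refine Metric.uniformContinuous_iff.2 fun ε hε => ?_
  obtain ⟨δ, hδ, h⟩ := exists_delta_fun (M := M) (τ := τ) f (half_pos hε)
  exact ⟨δ, hδ, fun x y hxy => (h x y fun i => (dist_le_pi_dist x y i).trans_lt hxy).trans_lt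
    (half_lt_self hε)⟩

theorem uniformContinuous_relMap {n : ℕ} (R : τ.Relations n) :
    UniformContinuous (PreStructure.relMap (τ := τ) (M := M) R) := by
  refine Metric.uniformContinuous_iff.2 fun ε hε => ?_
  obtain ⟨δ, hδ, h⟩ := exists_delta_rel (M := M) (τ := τ) R (half_pos hε)
  exact ⟨δ, hδ, fun x y hxy => (h x y fun i => (dist_le_pi_dist x y i).trans_lt hxy).trans_lt
    (half_lt_self hε)⟩

variable (M) in
/-- The extension of a function symbol to the completion. -/
noncomputable def cFun {n : ℕ} (f : τ.Functions n) : (Fin n → Completion M) → Completion M :=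
  ((isUniformInducing_coePi n).isDenseInducing (denseRange_coePi n)).extend
    fun x : Fin n → M => ((PreStructure.funMap (τ := τ) f x : M) : Completion M)

variable (M) in
/-- The extension of a predicate symbol to the completion. -/
noncomputable def cRel {n : ℕ} (R : τ.Relations n) : (Fin n → Completion M) → ℝ :=
  ((isUniformInducing_coePi n).isDenseInducing (denseRange_coePi n)).extend
    fun x : Fin n → M => PreStructure.relMap (τ := τ) R x

theorem continuous_cFun {n : ℕ} (f : τ.Functions n) : Continuous (cFun M f) :=
  (uniformContinuous_uniformly_extend (isUniformInducing_coePi n) (denseRange_coePi n)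
    ((Completion.uniformContinuous_coe M).comp (uniformContinuous_funMap f))).continuous

theorem continuous_cRel {n : ℕ} (R : τ.Relations n) : Continuous (cRel M R) :=
  (uniformContinuous_uniformly_extend (isUniformInducing_coePi n) (denseRange_coePi n)
    (uniformContinuous_relMap R)).continuous

theorem cFun_coe {n : ℕ} (f : τ.Functions n) (x : Fin n → M) :
    cFun M f (coePi M n x) = ((PreStructure.funMap (τ := τ) f x : M) : Completion M) :=
  uniformly_extend_of_ind (isUniformInducing_coePi n) (denseRange_coePi n)
    ((Completion.uniformContinuous_coe M).comp (uniformContinuous_funMap f)) x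

theorem cRel_coe {n : ℕ} (R : τ.Relations n) (x : Fin n → M) :
    cRel M R (coePi M n x) = PreStructure.relMap (τ := τ) R x :=
  uniformly_extend_of_ind (isUniformInducing_coePi n) (denseRange_coePi n)
    (uniformContinuous_relMap R) x

theorem isOpen_setOf_forall_dist_lt {X : Type*} [PseudoMetricSpace X] {n : ℕ} (δ : ℝ) :
    IsOpen {p : (Fin n → X) × (Fin n → X) | ∀ i, dist (p.1 i) (p.2 i) < δ} := by
  simp only [Set.ofPred_forall]
  exact isOpen_iInter_of_finite fun i => isOpen_lt (by fun_prop) continuous_const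

noncomputable instance Completion.instCStructure : CStructure τ (Completion M) where
  nonempty := (PreStructure.nonempty τ (M := M)).map (↑)
  complete := inferInstance
  dist_le_one x y := by
    refine Completion.induction_on₂ x y
      (isClosed_le (by fun_prop) continuous_const) fun a b => ?_
    rw [Completion.dist_eq]
    exact PreStructure.dist_le_one τ a b
  funMap f := cFun M f
  relMap R := cRel M R
  relMap_mem {n} R x := by
    refine (denseRange_coePi n).induction_on
      (p := fun x => cRel M R x ∈ Set.Icc (0 : ℝ) 1) x
      (isClosed_Icc.preimage (continuous_cRel R)) fun a => ?_
    rw [cRel_coe]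
    exact PreStructure.relMap_mem R a
  funMap_unif {n} f ε hε x y hxy := by
    have := DenseRange.subset_of_isOpen_of_isClosed
      ((denseRange_coePi (M := M) n).prodMap (denseRange_coePi n))
      (isOpen_setOf_forall_dist_lt (τ.funMod f ε))
      (C := {p | dist (cFun M f p.1) (cFun M f p.2) ≤ ε})
      (isClosed_le (((continuous_cFun f).comp continuous_fst).dist
        ((continuous_cFun f).comp continuous_snd)) continuous_const) ?_
    · exact @this (x, y) hxy
    · rintro ⟨a, b⟩ hab
      simp only [Prod.map, Set.mem_ofPred_eq, cFun_coe, Completion.dist_eq]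
      exact PreStructure.funMap_unif f ε hε a b fun i => by
        simpa [coePi, Completion.dist_eq] using hab i
  relMap_unif {n} R ε hε x y hxy := by
    have := DenseRange.subset_of_isOpen_of_isClosed
      ((denseRange_coePi (M := M) n).prodMap (denseRange_coePi n))
      (isOpen_setOf_forall_dist_lt (τ.relMod R ε))
      (C := {p | |cRel M R p.1 - cRel M R p.2| ≤ ε})
      (isClosed_le (((continuous_cRel R).comp continuous_fst).sub
        ((continuous_cRel R).comp continuous_snd)).abs continuous_const) ?_
    · exact @this (x, y) hxy
    · rintro ⟨a, b⟩ hab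
      simp only [Prod.map, Set.mem_ofPred_eq, cRel_coe]
      exact PreStructure.relMap_unif R ε hε a b fun i => by
        simpa [coePi, Completion.dist_eq] using hab i

theorem isElem_coe_completion : IsElem τ ((↑) : M → Completion M) :=
  isElem_of_denseRange Completion.denseRange_coe (fun _ F x => (cFun_coe F x).symm)
    (fun _ R x => cRel_coe R x) Completion.dist_eq

end Completion

open Filter Topology

/-! ### Ultrapowers and Łoś's theorem -/

section Ultrapower

/-- The underlying type of the ultrapower of `M` by `U`, before identification of points at
distance `0`. -/
def UPow {I : Type u} (_ : Ultrafilter I) (M : Type u) : Type u := I → M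

variable {I : Type u} (U : Ultrafilter I)

/-- The element of the ultrapower given by a family. -/
def UPow.mk {M : Type u} (f : I → M) : UPow U M := f

theorem exists_tendsto_of_mem_Icc {f : I → ℝ} (h : ∀ i, f i ∈ Set.Icc (0 : ℝ) 1) :
    ∃ r, Tendsto f U (𝓝 r) := by
  obtain ⟨r, -, hr⟩ := isCompact_Icc.ultrafilter_le_nhds (U.map f)
    (le_principal_iff.2 (Ultrafilter.mem_map.2 (univ_mem' h)))
  exact ⟨r, hr⟩

/-- The limit of a function along an ultrafilter. -/
noncomputable def ulim (f : I → ℝ) : ℝ := limUnder (U : Filter I) f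

theorem tendsto_ulim {f : I → ℝ} (h : ∀ i, f i ∈ Set.Icc (0 : ℝ) 1) :
    Tendsto f U (𝓝 (ulim U f)) :=
  tendsto_nhds_limUnder (exists_tendsto_of_mem_Icc U h)

theorem ulim_eq {f : I → ℝ} {r : ℝ} (h : Tendsto f U (𝓝 r)) : ulim U f = r := h.limUnder_eq

variable {M : Type u} [PseudoMetricSpace M]

theorem tendsto_ulim_dist (τ : Lang.{u}) [PreStructure τ M] (x y : I → M) :
    Tendsto (fun i => dist (x i) (y i)) U (𝓝 (ulim U fun i => dist (x i) (y i))) :=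
  tendsto_ulim U fun _ => ⟨dist_nonneg, PreStructure.dist_le_one τ _ _⟩

/-- The pseudometric of the ultrapower. -/
@[reducible] noncomputable def UPow.pseudoMetricSpace (τ : Lang.{u}) [PreStructure τ M] :
    PseudoMetricSpace (UPow U M) where
  dist x y := ulim U fun i => dist (x i) (y i)
  dist_self x := ulim_eq U (by simp)
  dist_comm x y := by simp only [dist_comm]
  dist_triangle x y z := le_of_tendsto_of_tendsto' (tendsto_ulim_dist U τ x z)
    ((tendsto_ulim_dist U τ x y).add (tendsto_ulim_dist U τ y z))
    fun i => dist_triangle _ _ _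

/-- The strict inequality at the limit is what makes it hold along the ultrafilter, for finitely
many coordinates at once. The moduli then apply at almost every index, and their weak conclusions
survive the limit. -/
theorem UPow.eventually_dist_lt [PreStructure τ M] {k : ℕ} {x y : Fin k → I → M} {δ : ℝ}
    (h : ∀ j, ulim U (fun i => dist (x j i) (y j i)) < δ) :
    ∀ᶠ i in U, ∀ j, dist (x j i) (y j i) < δ :=
  eventually_all.2 fun j => (tendsto_ulim_dist U τ (x j) (y j)).eventually_lt_const (h j)

/-- The ultrapower of a prestructure. -/
@[reducible] noncomputable def UPow.preStructure (τ : Lang.{u}) [PreStructure τ M] :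
    @PreStructure τ (UPow U M) (UPow.pseudoMetricSpace U τ) :=
  letI := UPow.pseudoMetricSpace (M := M) U τ
  { nonempty := (PreStructure.nonempty τ (M := M)).map fun a _ => a
    dist_le_one := fun x y => le_of_tendsto' (tendsto_ulim_dist U τ x y)
      fun i => PreStructure.dist_le_one τ _ _
    funMap := fun f x i => PreStructure.funMap f fun j => x j i
    relMap := fun R x => ulim U fun i => PreStructure.relMap R fun j => x j i
    relMap_mem := fun R x => isClosed_Icc.mem_of_tendsto
      (tendsto_ulim U fun i => PreStructure.relMap_mem R _)
      (Eventually.of_forall fun i => PreStructure.relMap_mem R _)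
    funMap_unif := fun f ε hε x y h => by
      refine le_of_tendsto (tendsto_ulim_dist U τ _ _) ?_
      filter_upwards [UPow.eventually_dist_lt (τ := τ) U h] with i hi
      exact PreStructure.funMap_unif f ε hε _ _ hi
    relMap_unif := fun R ε hε x y h => by
      refine le_of_tendsto ((tendsto_ulim U fun i => PreStructure.relMap_mem R _).sub
        (tendsto_ulim U fun i => PreStructure.relMap_mem R _)).abs ?_
      filter_upwards [UPow.eventually_dist_lt (τ := τ) U h] with i hi
      exact PreStructure.relMap_unif R ε hε _ _ hi }

variable [PreStructure τ M]

theorem UPow.tval_apply {n : ℕ} (t : τ.Term n) (x : Fin n → UPow U M) (i : I) :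
    letI := UPow.pseudoMetricSpace (M := M) U τ
    letI := UPow.preStructure (M := M) U τ
    tval x t i = tval (fun j => x j i) t := by
  let _ := UPow.pseudoMetricSpace (M := M) U τ
  let _ := UPow.preStructure (M := M) U τ
  induction t with
  | var i => rfl
  | func f ts ih => exact congrArg (PreStructure.funMap (τ := τ) f) (funext ih)

theorem UPow.snoc_apply {M : Type u} {n : ℕ} (x : Fin n → UPow U M) (y : UPow U M) (i : I) :
    (fun j => (Fin.snoc (α := fun _ => UPow U M) x y j : UPow U M) i) =
      Fin.snoc (α := fun _ => M) (fun j => x j i) (y i) :=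
  comp_snoc_eq (fun z : UPow U M => z i) x y

/-- Łoś's theorem. -/
theorem UPow.tendsto_peval {n : ℕ} (φ : τ.Fml n) (x : Fin n → UPow U M) :
    letI := UPow.pseudoMetricSpace (M := M) U τ
    letI := UPow.preStructure (M := M) U τ
    Tendsto (fun i => peval φ fun j => x j i) U (𝓝 (peval φ x)) := by
  let _ := UPow.pseudoMetricSpace (M := M) U τ
  let _ := UPow.preStructure (M := M) U τ
  show Tendsto (fun i => peval φ fun j => x j i) U (𝓝 (peval φ x))
  induction φ with
  | rel R ts =>
    simp only [peval, ← UPow.tval_apply]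
    exact tendsto_ulim U fun i => PreStructure.relMap_mem R _
  | dist s t =>
    simp only [peval, ← UPow.tval_apply]
    exact tendsto_ulim_dist U τ _ _
  | zero => exact tendsto_const_nhds
  | one => exact tendsto_const_nhds
  | half φ ih => exact (ih x).div_const 2
  | monus φ ψ ih ih' => exact ((ih x).sub (ih' x)).max tendsto_const_nhds
  | sup φ ih =>
    have hL := tendsto_ulim U fun i => peval_mem (.sup φ) fun j => x j i
    convert hL
    have key : ∀ y : UPow U M, Tendsto (fun i => peval φ
        (Fin.snoc (α := fun _ => M) (fun j => x j i) (y i))) U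
        (𝓝 (peval φ (Fin.snoc (α := fun _ => UPow U M) x y))) := fun y => by
      simpa only [UPow.snoc_apply] using ih (Fin.snoc (α := fun _ => UPow U M) x y)
    apply le_antisymm
    · exact (peval_sup_le_iff _ _ _).2 fun y =>
        le_of_tendsto_of_tendsto' (key y) hL fun i => peval_le_sup _ _ _
    · refine le_of_forall_pos_le_add fun ε hε => ?_
      -- Near-maximizers chosen at each index form one point `y` of the ultrapower, whose value is
      -- within `ε` of the limit of the suprema.
      have : ∀ i, ∃ a : M, peval (.sup φ) (fun j => x j i) - ε <
          peval φ (Fin.snoc (α := fun _ => M) (fun j => x j i) a) :=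
        fun i => exists_lt_of_lt_peval_sup (sub_lt_self _ hε)
      choose y hy using this
      have h1 := le_of_tendsto_of_tendsto' hL ((key y).add_const ε)
        fun i => by linarith [hy i]
      linarith [peval_le_sup φ x y]
  | inf φ ih =>
    have hL := tendsto_ulim U fun i => peval_mem (.inf φ) fun j => x j i
    convert hL
    have key : ∀ y : UPow U M, Tendsto (fun i => peval φ
        (Fin.snoc (α := fun _ => M) (fun j => x j i) (y i))) U
        (𝓝 (peval φ (Fin.snoc (α := fun _ => UPow U M) x y))) := fun y => by
      simpa only [UPow.snoc_apply] using ih (Fin.snoc (α := fun _ => UPow U M) x y)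
    apply le_antisymm
    · refine le_of_forall_pos_le_add fun ε hε => ?_
      have : ∀ i, ∃ a : M, peval φ (Fin.snoc (α := fun _ => M) (fun j => x j i) a) <
          peval (.inf φ) (fun j => x j i) + ε :=
        fun i => exists_lt_of_peval_inf_lt (lt_add_of_pos_right _ hε)
      choose y hy using this
      have h1 := le_of_tendsto_of_tendsto' (key y) (hL.add_const ε)
        fun i => (hy i).le
      linarith [peval_inf_le φ x y]
    · exact (le_peval_inf_iff _ _ _).2 fun y =>
        le_of_tendsto_of_tendsto' hL (key y) fun i => peval_inf_le _ _ _

end Ultrapower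

/-! ### Expressive power of the connectives -/

section Connectives

/-- `max φ ψ`. -/
def Lang.Fml.max {n : ℕ} (φ ψ : τ.Fml n) : τ.Fml n :=
  .monus .one (.monus (.monus .one φ) (.monus ψ φ))

/-- `|φ - ψ|`. -/
def Lang.Fml.absDiff {n : ℕ} (φ ψ : τ.Fml n) : τ.Fml n := (φ.monus ψ).max (ψ.monus φ)

/-- The constant formula `2⁻ᵏ`. -/
def Lang.Fml.twoPow {n : ℕ} : ℕ → τ.Fml n
  | 0 => .one
  | k + 1 => .half (twoPow k)

/-- The constant formula `1 - j / 2ᵏ`. -/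
def Lang.Fml.dyadic {n : ℕ} (k : ℕ) : ℕ → τ.Fml n
  | 0 => .one
  | j + 1 => .monus (dyadic k j) (.twoPow k)

variable {M : Type u} [PseudoMetricSpace M] [PreStructure τ M] {n : ℕ} (x : Fin n → M)

/-- Since $\phi+(\psi\mathbin{\dot-}\phi)=\max(\phi,\psi)\le1$, the outer subtractions are not
truncated, and complementing twice turns subtraction into addition. -/
theorem peval_max (φ ψ : τ.Fml n) : peval (φ.max ψ) x = max (peval φ x) (peval ψ x) := by
  obtain ⟨h0, h1⟩ := peval_mem φ x
  obtain ⟨h2, h3⟩ := peval_mem ψ x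
  simp only [Lang.Fml.max, peval]
  rcases le_total (peval φ x) (peval ψ x) with h | h
  · rw [max_eq_right h, max_eq_left (a := peval ψ x - peval φ x) (by linarith),
      max_eq_left (a := 1 - peval φ x) (by linarith),
      max_eq_left (a := 1 - peval φ x - _) (by linarith), max_eq_left] <;> linarith
  · rw [max_eq_left h, max_eq_right (a := peval ψ x - peval φ x) (by linarith),
      max_eq_left (a := 1 - peval φ x) (by linarith),
      max_eq_left (a := 1 - peval φ x - _) (by linarith), max_eq_left] <;> linarith

theorem peval_absDiff (φ ψ : τ.Fml n) :
    peval (φ.absDiff ψ) x = |peval φ x - peval ψ x| := by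
  simp only [Lang.Fml.absDiff, peval_max, peval]
  rcases le_total (peval φ x) (peval ψ x) with h | h
  · rw [abs_of_nonpos (by linarith), max_eq_right (a := peval φ x - peval ψ x) (by linarith),
      max_eq_left (a := peval ψ x - peval φ x) (by linarith), max_eq_right] <;> linarith
  · rw [abs_of_nonneg (by linarith), max_eq_right (a := peval ψ x - peval φ x) (by linarith),
      max_eq_left (a := peval φ x - peval ψ x) (by linarith), max_eq_left]; linarith

theorem peval_twoPow (k : ℕ) : peval (.twoPow k : τ.Fml n) x = 1 / 2 ^ k := by
  induction k with
  | zero => simp [Lang.Fml.twoPow, peval]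
  | succ k ih => simp only [Lang.Fml.twoPow, peval, ih]; rw [pow_succ]; field_simp

/-- The bound $j\le 2^k$ keeps every subtraction above the truncation. -/
theorem peval_dyadic (k j : ℕ) (hj : j ≤ 2 ^ k) :
    peval (.dyadic k j : τ.Fml n) x = 1 - j / 2 ^ k := by
  induction j with
  | zero => simp [Lang.Fml.dyadic, peval]
  | succ j ih =>
    simp only [Lang.Fml.dyadic, peval, ih (by omega), peval_twoPow]
    have : ((j + 1 : ℕ) : ℝ) / 2 ^ k ≤ 1 := by
      rw [div_le_one (by positivity)]
      exact_mod_cast hj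
    rw [max_eq_left]
    · push_cast; ring
    · push_cast at this
      rw [add_div] at this
      linarith

/-- The dyadic constant formulas are dense in `[0,1]`. -/
theorem exists_const_formula (τ : Lang.{u}) (n : ℕ) {r ε : ℝ} (hr : r ∈ Set.Icc (0 : ℝ) 1)
    (hε : 0 < ε) : ∃ (χ : τ.Fml n) (q : ℝ), r ≤ q ∧ q < r + ε ∧
      ∀ (M : Type u) [PseudoMetricSpace M] [PreStructure τ M] (x : Fin n → M),
        peval χ x = q := by
  obtain ⟨k, hk⟩ := exists_pow_lt_of_lt_one hε (by norm_num : (1 / 2 : ℝ) < 1)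
  rw [one_div_pow] at hk
  have h2 : (0 : ℝ) < 2 ^ k := by positivity
  have hnn : 0 ≤ (1 - r) * 2 ^ k := mul_nonneg (by linarith [hr.2]) h2.le
  have h3 := Nat.floor_le hnn
  have h4 := Nat.lt_floor_add_one ((1 - r) * 2 ^ k)
  have h5 : ⌊(1 - r) * 2 ^ k⌋₊ ≤ 2 ^ k := by
    rw [← Nat.cast_le (α := ℝ)]
    push_cast
    nlinarith [hr.1]
  -- Rounding $1-r$ down to a multiple of $2^{-k}<\varepsilon$ rounds $r$ up by less than
  -- $\varepsilon$.
  refine ⟨.dyadic k ⌊(1 - r) * 2 ^ k⌋₊, _, ?_, ?_, fun M _ _ x => peval_dyadic x _ _ h5⟩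
  · rw [← div_le_iff₀ h2] at h3
    linarith
  · have h6 : 1 - r < ⌊(1 - r) * 2 ^ k⌋₊ / 2 ^ k + 1 / 2 ^ k := by
      rw [← add_div, lt_div_iff₀ h2]
      exact h4
    linarith

/-- If all conditions `φ = 0` pass from `x` to `y`, then all formulas have the same value. -/
theorem peval_eq_of_zero_imp {N : Type u} [PseudoMetricSpace N] [PreStructure τ N]
    {x : Fin n → M} {y : Fin n → N}
    (h : ∀ φ : τ.Fml n, peval φ x = 0 → peval φ y = 0) (φ : τ.Fml n) :
    peval φ y = peval φ x := by
  -- With `q` a constant slightly above $\phi(x)$, the formula $\phi\mathbin{\dot-}q$ vanishes at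
  -- `x`, hence at `y`, so $\phi(y)\le q$.
  have key : ∀ φ : τ.Fml n, peval φ y ≤ peval φ x := fun φ => by
    refine le_of_forall_pos_le_add fun ε hε => ?_
    obtain ⟨χ, q, h1, h2, h3⟩ := exists_const_formula τ n (peval_mem φ x) hε
    have := h (.monus φ χ) (by simp only [peval, h3]; exact max_eq_right (by linarith))
    simp only [peval, h3] at this
    linarith [le_max_left (peval φ y - q) 0]
  refine le_antisymm (key φ) ?_
  -- Complementation reverses the inequality.
  have := key (.monus .one φ)
  simp only [peval] at this
  rw [max_eq_left (by linarith [(peval_mem φ y).2]),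
    max_eq_left (by linarith [(peval_mem φ x).2])] at this
  linarith

/-- Finitely many approximate values can be expressed by one formula. -/
theorem exists_formula_approx {ι : Type*} [Finite ι] (ψ : ι → τ.Fml n) {ε : ℝ} (hε : 0 < ε) :
    ∃ θ : τ.Fml n, peval θ x < ε ∧
      ∀ (N : Type u) [PseudoMetricSpace N] [PreStructure τ N] (y : Fin n → N),
        peval θ y < ε → ∀ i, |peval (ψ i) y - peval (ψ i) x| ≤ 2 * ε := by
  classical
  have := Fintype.ofFinite ι
  suffices H : ∀ s : Finset ι, ∃ θ : τ.Fml n, peval θ x < ε ∧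
      ∀ (N : Type u) [PseudoMetricSpace N] [PreStructure τ N] (y : Fin n → N),
        peval θ y < ε → ∀ i ∈ s, |peval (ψ i) y - peval (ψ i) x| ≤ 2 * ε by
    obtain ⟨θ, h1, h2⟩ := H Finset.univ
    exact ⟨θ, h1, fun N _ _ y hy i => h2 N y hy i (Finset.mem_univ i)⟩
  intro s
  induction s using Finset.induction_on with
  | empty => exact ⟨.zero, hε, fun N _ _ y _ i hi => by simp at hi⟩
  | insert j s _ ih =>
    obtain ⟨θ, h1, h2⟩ := ih
    obtain ⟨χ, q, h3, h4, h5⟩ := exists_const_formula τ n (peval_mem (ψ j) x) hε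
    -- The constant `χ` stands in for the possibly undefinable value of `ψ j` at `x`. It is off by
    -- less than `ε`, and smallness of `θ` costs another `ε`; hence the factor $2$.
    refine ⟨θ.max ((ψ j).absDiff χ), ?_, fun N _ _ y hy i hi => ?_⟩
    · rw [peval_max, peval_absDiff, h5]
      exact max_lt h1 (abs_lt.2 ⟨by linarith, by linarith⟩)
    · rw [peval_max, peval_absDiff, h5, max_lt_iff, abs_lt] at hy
      rcases Finset.mem_insert.1 hi with rfl | hi
      · rw [abs_le]
        constructor <;> linarith [hy.2.1, hy.2.2]
      · exact h2 N y hy.1 i hi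

/-- The infimum over the last `m` variables. -/
def Lang.Fml.infs {l : ℕ} : (m : ℕ) → τ.Fml (l + m) → τ.Fml l
  | 0, φ => φ
  | m + 1, φ => infs m (.inf φ)

theorem append_snoc_eq {α : Type*} {l m : ℕ} (x : Fin l → α) (e : Fin m → α) (a : α) :
    Fin.append x (Fin.snoc (α := fun _ => α) e a) =
      Fin.snoc (α := fun _ => α) (n := l + m) (Fin.append x e) a := by
  funext i
  refine Fin.addCases (fun j => ?_) (fun j => ?_) i
  · rw [Fin.append_left]
    exact ((Fin.snoc_castSucc (α := fun _ => α) a (Fin.append x e) (Fin.castAdd m j)).trans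
      (Fin.append_left _ _ _)).symm
  · rw [Fin.append_right]
    refine Fin.lastCases ?_ (fun k => ?_) j
    · rw [Fin.snoc_last]
      exact (Fin.snoc_last (α := fun _ => α) a (Fin.append x e)).symm
    · rw [Fin.snoc_castSucc]
      exact ((Fin.snoc_castSucc (α := fun _ => α) a (Fin.append x e) (Fin.natAdd l k)).trans
        (Fin.append_right _ _ _)).symm

/-- The inequality is strict because an infimum need not be attained, whereas `inf < r` always has a
witness. -/
theorem peval_infs_lt_iff {l : ℕ} (x : Fin l → M) {r : ℝ} (m : ℕ) (φ : τ.Fml (l + m)) :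
    peval (φ.infs m) x < r ↔ ∃ e : Fin m → M, peval φ (Fin.append x e) < r := by
  induction m with
  | zero =>
    refine ⟨fun h => ⟨Fin.elim0, ?_⟩, ?_⟩
    · rwa [Fin.append_elim0]
    · rintro ⟨e, he⟩
      rwa [Subsingleton.elim e Fin.elim0, Fin.append_elim0] at he
  | succ m ih =>
    refine (ih (.inf φ)).trans ⟨?_, ?_⟩
    · rintro ⟨e, he⟩
      obtain ⟨a, ha⟩ := exists_lt_of_peval_inf_lt he
      exact ⟨Fin.snoc (α := fun _ => M) e a, by rwa [append_snoc_eq]⟩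
    · rintro ⟨e, he⟩
      refine ⟨Fin.init (α := fun _ => M) e, (peval_inf_le φ _ (e (Fin.last m))).trans_lt ?_⟩
      rwa [← append_snoc_eq, Fin.snoc_init_self]

end Connectives

/-- `c` and `c'` have the same type. -/
def SameType (τ : Lang.{u}) {A M N : Type u} [PseudoMetricSpace M] [PreStructure τ M]
    [PseudoMetricSpace N] [PreStructure τ N] (c : A → M) (c' : A → N) : Prop :=
  ∀ (k : ℕ) (φ : τ.Fml k) (a : Fin k → A),
    peval φ (fun i => c (a i)) = peval φ (fun i => c' (a i))

/-- Formulas with parameters from `A` and elements of `N` substituted for the variables. -/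
abbrev ParamFml (τ : Lang.{u}) (A N : Type u) : Type u := Σ k : ℕ, τ.Fml k × (Fin k → A ⊕ N)

/-! ### Compactness: realizing types jointly -/

section Approx

variable {A M N : Type u} [PseudoMetricSpace M] [PreStructure τ M] [PseudoMetricSpace N]
  [PreStructure τ N]

/-- Every finite subset of a disjoint sum is listed, up to repetition, by a tuple of left
elements and an injective tuple of right elements. -/
theorem exists_enumeration {A N : Type u} (F : Set (A ⊕ N)) (hF : F.Finite) :
    ∃ (l m : ℕ) (b : Fin l → A) (e : Fin m → N), Function.Injective e ∧
      ∀ z ∈ F, ∃ i, Fin.append (fun j => (Sum.inl (b j) : A ⊕ N)) (fun j => Sum.inr (e j)) i = z := by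
  obtain ⟨l, ⟨b⟩⟩ := @Finite.exists_equiv_fin _ (hF.preimage (f := Sum.inl) Sum.inl_injective.injOn)
  obtain ⟨m, ⟨e⟩⟩ := @Finite.exists_equiv_fin _ (hF.preimage (f := Sum.inr) Sum.inr_injective.injOn)
  refine ⟨l, m, fun j => b.symm j, fun j => e.symm j,
    Subtype.val_injective.comp e.symm.injective, ?_⟩
  rintro (a | n) hz
  · exact ⟨Fin.castAdd m (b ⟨a, hz⟩), by simp⟩
  · exact ⟨Fin.natAdd l (e ⟨n, hz⟩), by simp⟩

/-- Finitely many formulas in parameters from `A` and elements of `N` have approximately the same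
values at suitable elements of `M`. -/
theorem SameType.exists_approx {c : A → M} {c' : A → N} (h : SameType τ c c')
    (s : Set (ParamFml τ A N)) (hs : s.Finite) {ε : ℝ} (hε : 0 < ε) :
    ∃ g : N → M, ∀ C ∈ s, |peval C.2.1 (fun i => Sum.elim c g (C.2.2 i)) -
      peval C.2.1 (fun i => Sum.elim c' id (C.2.2 i))| ≤ ε := by
  classical
  -- The finitely many formulas are rewritten in one tuple of variables: `l` for parameters from
  -- `A`, then `m` for elements of `N`.
  obtain ⟨l, m, b, e, he, hF⟩ := exists_enumeration (⋃ C ∈ s, Set.range C.2.2)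
    (hs.biUnion fun C _ => Set.finite_range _)
  have hσ : ∀ C : s, ∃ σ : Fin C.1.1 → Fin (l + m), ∀ i,
      Fin.append (fun j => (Sum.inl (b j) : A ⊕ N)) (fun j => Sum.inr (e j)) (σ i) = C.1.2.2 i :=
    fun C => Classical.skolem.1 fun i => hF _ (Set.mem_biUnion C.2 ⟨i, rfl⟩)
  choose σ hσ using hσ
  have : Finite s := hs
  have key : ∀ {P : Type u} [PseudoMetricSpace P] [PreStructure τ P] (c₁ : A → P) (g : N → P)
      (C : s), peval (C.1.2.1.subst fun i => .var (σ C i))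
        (Fin.append (fun j => c₁ (b j)) fun j => g (e j)) =
      peval C.1.2.1 fun i => Sum.elim c₁ g (C.1.2.2 i) := by
    intro P _ _ c₁ g C
    rw [peval_subst]
    congr 1
    funext i
    rw [← hσ C i]
    generalize σ C i = k
    refine Fin.addCases (fun j => ?_) (fun j => ?_) k <;> simp [tval]
  obtain ⟨θ, h1, h2⟩ := exists_formula_approx (Fin.append (fun j => c' (b j)) e)
    (fun C : s => C.1.2.1.subst fun i => .var (σ C i)) (half_pos hε)
  -- Once the elements of `N` are quantified away, only parameters from `A` remain, and the equality
  -- of types transfers the value to `M`.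
  have h3 : peval (θ.infs m) (fun j => c (b j)) < ε / 2 := by
    rw [h l]
    exact (peval_infs_lt_iff _ m θ).2 ⟨e, h1⟩
  obtain ⟨e', he'⟩ := (peval_infs_lt_iff _ m θ).1 h3
  have : Nonempty M := PreStructure.nonempty τ
  -- Injectivity of `e` makes $e_j\mapsto e'_j$ a function; elements that do not occur in `s` go
  -- anywhere.
  refine ⟨Function.extend e e' fun _ => Classical.arbitrary M, fun C hC => ?_⟩
  have h4 := h2 M _ he' ⟨C, hC⟩
  have h5 := key c' id ⟨C, hC⟩
  have h6 := key c (Function.extend e e' fun _ => Classical.arbitrary M) ⟨C, hC⟩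
  simp only [he.extend_apply] at h6
  simp only [id] at h5
  rw [h5, h6] at h4
  linarith

end Approx

/-- Any family of prestructures with elements of the same type as in `M` can be embedded
elementarily, together with `M`, into one structure in which these elements are identified. -/
theorem exists_joint_extension {A M : Type u} [PseudoMetricSpace M] [PreStructure τ M] (c : A → M)
    {P : Type u} (N : P → Type u) [∀ p, PseudoMetricSpace (N p)] [∀ p, PreStructure τ (N p)]
    (c' : ∀ p, A → N p) (h : ∀ p, SameType τ c (c' p)) :
    ∃ (Q : Type u) (_ : MetricSpace Q) (_ : CStructure τ Q) (f : M → Q) (g : ∀ p, N p → Q),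
      IsElem τ f ∧ ∀ p, IsElem τ (g p) ∧ ∀ a, g p (c' p a) = f (c a) := by
  classical
  -- An index is a finite set of formulas to be respected together with a precision. An ultrafilter
  -- finer than `atTop` eventually respects each formula to any precision. Different `p` need no
  -- compatibility, since each is approximated in `M` separately.
  let I : Type u := Finset (Σ p : P, ParamFml τ A (N p)) × ℕ
  have hg : ∀ (p : P) (i : I), ∃ g : N p → M, ∀ C : ParamFml τ A (N p), Sigma.mk p C ∈ i.1 →
      |peval C.2.1 (fun j => Sum.elim c g (C.2.2 j)) -
        peval C.2.1 (fun j => Sum.elim (c' p) id (C.2.2 j))| ≤ 1 / ((i.2 : ℝ) + 1) := fun p i => by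
    have hfin : (Sigma.mk (β := fun p => ParamFml τ A (N p)) p ⁻¹' i.1).Finite :=
      i.1.finite_toSet.preimage sigma_mk_injective.injOn
    exact (h p).exists_approx _ hfin Nat.one_div_pos_of_nat
  choose g hg using hg
  have : (atTop : Filter I).NeBot := by
    rw [← prod_atTop_atTop_eq]
    infer_instance
  let U : Ultrafilter I := Ultrafilter.of atTop
  have hU : (U : Filter I) ≤ atTop := Ultrafilter.of_le _
  have lim : ∀ (p : P) (C : ParamFml τ A (N p)),
      Tendsto (fun i : I => peval C.2.1 (fun j => Sum.elim c (g p i) (C.2.2 j))) U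
        (𝓝 (peval C.2.1 (fun j => Sum.elim (c' p) id (C.2.2 j)))) := fun p C => by
    refine Tendsto.mono_left ?_ hU
    rw [tendsto_iff_dist_tendsto_zero]
    have h0 : Tendsto (fun i : I => 1 / ((i.2 : ℝ) + 1)) atTop (𝓝 0) := by
      have : Tendsto (fun i : I => i.2) atTop atTop := by
        rw [← prod_atTop_atTop_eq]
        exact tendsto_snd
      exact tendsto_one_div_add_atTop_nhds_zero_nat.comp this
    refine squeeze_zero' (Eventually.of_forall fun _ => dist_nonneg) ?_ h0
    filter_upwards [eventually_ge_atTop (({⟨p, C⟩}, 0) : I)] with i hi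
    exact hg p i C (Finset.singleton_subset_iff.1 hi.1)
  let _ := UPow.pseudoMetricSpace (M := M) U τ
  let _ := UPow.preStructure (M := M) U τ
  refine ⟨UniformSpace.Completion (UPow U M), inferInstance, inferInstance,
    fun a => (UPow.mk U (fun _ => a) : UniformSpace.Completion (UPow U M)),
    fun p a => (UPow.mk U (fun i => g p i a) : UniformSpace.Completion (UPow U M)), ?_,
    fun p => ⟨?_, fun a => ?_⟩⟩
  · refine isElem_coe_completion.comp (f := fun a => UPow.mk U fun _ => a) fun n φ x => ?_
    exact tendsto_nhds_unique (UPow.tendsto_peval U φ _) tendsto_const_nhds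
  · refine isElem_coe_completion.comp (f := fun a => UPow.mk U fun i => g p i a) fun n φ x => ?_
    exact tendsto_nhds_unique (UPow.tendsto_peval U φ _) (lim p ⟨n, φ, fun j => .inr (x j)⟩)
  -- In the ultrapower the two points are only at distance $0$; the completion is separated and
  -- identifies them.
  · refine eq_of_dist_eq_zero ?_
    rw [UniformSpace.Completion.dist_eq]
    refine (ulim_eq U (f := fun i => dist (g p i (c' p a)) (c a)) ?_)
    have := lim p ⟨2, dFml τ, ![.inr (c' p a), .inl a]⟩
    simpa [dFml, peval, tval] using this

/-! ### Counting formulas -/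

section Card

/-- The connectives and quantifiers. -/
inductive Connective
  | zero | one | half | monus | sup | inf

/-- The number of immediate subformulas. -/
def Connective.arity : Connective → ℕ
  | zero => 0
  | one => 0
  | half => 1
  | monus => 2
  | sup => 1
  | inf => 1

/-- The nodes of the syntax trees of formulas. -/
abbrev Node (τ : Lang.{u}) : Type u :=
  Σ n : ℕ, ((Σ k : ℕ, τ.Relations k × (Fin k → τ.Term n)) ⊕ (τ.Term n × τ.Term n)) ⊕ Connective

/-- The number of children of a node. -/
def Node.arity : Node τ → ℕ
  | ⟨_, .inl _⟩ => 0
  | ⟨_, .inr c⟩ => c.arity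

/-- The syntax tree of a formula. -/
def Lang.Fml.tree : {n : ℕ} → τ.Fml n → WType fun a : Node τ => Fin a.arity
  | n, .rel R ts => ⟨⟨n, .inl (.inl ⟨_, R, ts⟩)⟩, Fin.elim0⟩
  | n, .dist s t => ⟨⟨n, .inl (.inr (s, t))⟩, Fin.elim0⟩
  | n, .zero => ⟨⟨n, .inr .zero⟩, Fin.elim0⟩
  | n, .one => ⟨⟨n, .inr .one⟩, Fin.elim0⟩
  | n, .half φ => ⟨⟨n, .inr .half⟩, fun _ => φ.tree⟩
  | n, .monus φ ψ => ⟨⟨n, .inr .monus⟩, fun i => if i.1 = 0 then φ.tree else ψ.tree⟩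
  | n, .sup φ => ⟨⟨n, .inr .sup⟩, fun _ => φ.tree⟩
  | n, .inf φ => ⟨⟨n, .inr .inf⟩, fun _ => φ.tree⟩

/-- Formulas thus embed in a W-type with finite branching, whose size is bounded by $\aleph_0$ and
the number of nodes. -/
theorem Lang.Fml.tree_injective {n : ℕ} (φ ψ : τ.Fml n) (h : φ.tree = ψ.tree) : φ = ψ := by
  induction φ with
  | rel R ts =>
    cases ψ <;> obtain ⟨h, -⟩ := WType.mk.inj h <;> simp at h
    obtain ⟨rfl, h⟩ := h
    simpa using h
  | dist s t =>
    cases ψ <;> obtain ⟨h, -⟩ := WType.mk.inj h <;> simp at h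
    rw [h.1, h.2]
  | zero => cases ψ <;> obtain ⟨h, -⟩ := WType.mk.inj h <;> simp at h; rfl
  | one => cases ψ <;> obtain ⟨h, -⟩ := WType.mk.inj h <;> simp at h; rfl
  | half φ ih =>
    cases ψ <;> obtain ⟨h, h'⟩ := WType.mk.inj h <;> simp at h
    rw [ih _ (congrFun (eq_of_heq h') (0 : Fin 1))]
  | monus φ φ' ih ih' =>
    cases ψ <;> obtain ⟨h, h'⟩ := WType.mk.inj h <;> simp at h
    rw [ih _ (congrFun (eq_of_heq h') (0 : Fin 2)), ih' _ (congrFun (eq_of_heq h') (1 : Fin 2))]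
  | sup φ ih =>
    cases ψ <;> obtain ⟨h, h'⟩ := WType.mk.inj h <;> simp at h
    rw [ih _ (congrFun (eq_of_heq h') (0 : Fin 1))]
  | inf φ ih =>
    cases ψ <;> obtain ⟨h, h'⟩ := WType.mk.inj h <;> simp at h
    rw [ih _ (congrFun (eq_of_heq h') (0 : Fin 1))]

variable {κ : Cardinal.{u}}

theorem mk_sigma_nat_le {f : ℕ → Type u} (h0 : ℵ₀ ≤ κ) (h : ∀ n, #(f n) ≤ κ) :
    #(Σ n, f n) ≤ κ := by
  rw [mk_sigma]
  refine (sum_le_sum _ (fun _ => κ) h).trans ?_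
  simpa using mul_le_of_le h0 h0 le_rfl

theorem mk_term_le (hκ : max ℵ₀ τ.card ≤ κ) (n : ℕ) : #(τ.Term n) ≤ κ := by
  have h0 := (le_max_left _ _).trans hκ
  refine FirstOrder.Language.Term.card_le.trans (max_le h0 ?_)
  rw [mk_sum]
  refine add_le_of_le h0 ?_ ?_
  · exact (lift_le_aleph0.2 mk_le_aleph0).trans h0
  · rw [lift_uzero]
    exact (self_le_add_right _ _).trans ((le_max_right _ _).trans hκ)

/-- The number of formulas. -/
theorem mk_fml_le (hκ : max ℵ₀ τ.card ≤ κ) (n : ℕ) : #(τ.Fml n) ≤ κ := by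
  have h0 := (le_max_left _ _).trans hκ
  refine (mk_le_of_injective (f := Lang.Fml.tree) fun φ ψ => φ.tree_injective ψ).trans ?_
  refine WType.cardinalMk_le_max_aleph0_of_finite'.trans (max_le ?_ h0)
  rw [lift_uzero]
  refine mk_sigma_nat_le h0 fun n => ?_
  simp only [mk_sum, lift_id, lift_uzero, mk_prod]
  have hR : ∀ k, #(τ.Relations k) ≤ κ := fun k =>
    (mk_le_of_injective sigma_mk_injective).trans
      ((self_le_add_left _ _).trans ((le_max_right _ _).trans hκ))
  refine add_le_of_le h0 (add_le_of_le h0 (mk_sigma_nat_le h0 fun k => ?_) ?_) ?_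
  · rw [mk_prod, lift_id, lift_id]
    refine mul_le_of_le h0 (hR k) ?_
    rw [mk_pi, prod_const, mk_fin, lift_natCast, lift_uzero]
    exact (power_le_power_right (mk_term_le hκ n)).trans (power_nat_le h0)
  · exact mul_le_of_le h0 (mk_term_le hκ n) (mk_term_le hκ n)
  · have : Finite Connective := Finite.of_injective (β := Fin 6)
      (fun | .zero => 0 | .one => 1 | .half => 2 | .monus => 3 | .sup => 4 | .inf => 5)
      (by rintro (_ | _) (_ | _) h <;> simp_all)
    exact (lift_le_aleph0.2 mk_le_aleph0).trans h0

end Card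

/-! ### Downward Löwenheim–Skolem -/

section LowenheimSkolem

/-- The functions of `τ` together with approximate Skolem functions. -/
def skolemLang (τ : Lang.{u}) : FirstOrder.Language.{u, u} where
  Functions n := τ.Functions n ⊕ (τ.Fml (n + 1) × ℚ × ℕ)
  Relations _ := PEmpty

variable {Q : Type u} [PseudoMetricSpace Q]

open Classical in
/-- The approximate Skolem functions search for an element at which `φ` has approximately the
value `q`. -/
@[reducible] noncomputable def skolemStructure (τ : Lang.{u}) [PreStructure τ Q] :
    (skolemLang τ).Structure Q where
  funMap := fun {_} F x => match F with
    | .inl f => PreStructure.funMap f x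
    | .inr (φ, q, m) =>
      if h : ∃ b, |peval φ (Fin.snoc (α := fun _ => Q) x b) - q| < 1 / ((m : ℝ) + 1)
      then h.choose else (PreStructure.nonempty τ (M := Q)).some
  RelMap := fun {_} R _ => PEmpty.elim R

/-- The downward Löwenheim–Skolem theorem. -/
theorem exists_elementary_subset [PreStructure τ Q] {κ : Cardinal.{u}} (hκ : max ℵ₀ τ.card ≤ κ)
    (S : Set Q) (hne : S.Nonempty) (hS : #S ≤ κ) :
    ∃ D : Set Q, S ⊆ D ∧ #D ≤ κ ∧
      ∃ _ : PreStructure τ D, IsElem τ (Subtype.val : D → Q) := by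
  let _ := skolemStructure (Q := Q) τ
  have h0 := (le_max_left _ _).trans hκ
  obtain ⟨D, hsub, hcard, hD⟩ : ∃ D : Set Q, S ⊆ D ∧ #D ≤ κ ∧
      ∀ {n : ℕ} (F : (skolemLang τ).Functions n) (x : Fin n → D),
        FirstOrder.Language.Structure.funMap F (fun i => (x i : Q)) ∈ D := by
    refine ⟨(FirstOrder.Language.Substructure.closure (skolemLang τ) S : Set Q),
      FirstOrder.Language.Substructure.subset_closure, ?_, fun F x =>
      (FirstOrder.Language.Substructure.closure (skolemLang τ) S).fun_mem F _ fun i => (x i).2⟩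
    have := FirstOrder.Language.Substructure.lift_card_closure_le (L := skolemLang τ) (s := S)
    rw [lift_id, lift_id, lift_id] at this
    refine this.trans (max_le h0 (add_le_of_le h0 hS (mk_sigma_nat_le h0 fun n => ?_)))
    refine (mk_sum _ _).trans_le ?_
    simp only [lift_id, mk_prod, lift_uzero]
    refine add_le_of_le h0 ?_ (mul_le_of_le h0 (mk_fml_le hκ _) ?_)
    · exact (mk_le_of_injective sigma_mk_injective).trans
        ((self_le_add_right _ _).trans ((le_max_right _ _).trans hκ))
    · exact (lift_le_aleph0.2 (mul_le_of_le le_rfl mk_le_aleph0 mk_le_aleph0)).trans h0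
  -- Closure under the function symbols is all that is needed; no limit points are added, so the
  -- cardinality stays at most `κ`.
  let inst : PreStructure τ D :=
      { nonempty := hne.elim fun a ha => ⟨⟨a, hsub ha⟩⟩
        dist_le_one := fun x y => PreStructure.dist_le_one τ (x : Q) (y : Q)
        funMap := fun f x => ⟨_, hD (.inl f) x⟩
        relMap := fun R x => PreStructure.relMap R fun i => (x i : Q)
        relMap_mem := fun R x => PreStructure.relMap_mem R _
        funMap_unif := fun f ε hε x y h => PreStructure.funMap_unif f ε hε _ _ h
        relMap_unif := fun R ε hε x y h => PreStructure.relMap_unif R ε hε _ _ h }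
  refine ⟨D, hsub, hcard, inst, ?_⟩
  refine isElem_of_approx (M := D) (fun _ _ _ => rfl) (fun _ _ _ => rfl) (fun _ _ => rfl)
    fun n φ x a ε hε => ?_
  -- The rational `q` is within $1/(m+1)<\varepsilon/2$ of the value at `a`, and the Skolem element
  -- attains `q` up to the same error.
  obtain ⟨m, hm⟩ := exists_nat_one_div_lt (half_pos hε)
  obtain ⟨q, hq1, hq2⟩ := exists_rat_btwn (lt_add_of_pos_right
    (peval φ (Fin.snoc (α := fun _ => Q) (fun i => (x i : Q)) a))
    (Nat.one_div_pos_of_nat (α := ℝ) (n := m)))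
  have hex : ∃ b, |peval φ (Fin.snoc (α := fun _ => Q) (fun i => (x i : Q)) b) - q| <
      1 / ((m : ℝ) + 1) := ⟨a, by rw [abs_lt]; constructor <;> linarith⟩
  obtain ⟨b, hb⟩ : ∃ b : D, (b : Q) = hex.choose :=
    ⟨⟨_, hD (.inr (φ, q, m)) x⟩, dif_pos hex⟩
  have h2 := abs_lt.1 hex.choose_spec
  rw [← hb] at h2
  exact ⟨b, abs_le.2 ⟨by linarith, by linarith⟩⟩

end LowenheimSkolem

/-! ### Rational approximation in the unit interval -/

section Rationals

theorem exists_QI_ge {v ε : ℝ} (hv : v ∈ Set.Icc (0 : ℝ) 1) (hε : 0 < ε) :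
    ∃ s : QI, v ≤ ((s : ℚ) : ℝ) ∧ ((s : ℚ) : ℝ) ≤ v + ε := by
  rcases le_or_gt 1 (v + ε) with h | h
  · exact ⟨⟨1, by norm_num, le_rfl⟩, by simpa using hv.2, by simpa using h⟩
  · obtain ⟨q, h1, h2⟩ := exists_rat_btwn (lt_add_of_pos_right v hε)
    exact ⟨⟨q, by exact_mod_cast (hv.1.trans h1.le), by exact_mod_cast (h2.trans h).le⟩,
      h1.le, h2.le⟩

theorem exists_QI_le {v ε : ℝ} (hv : v ∈ Set.Icc (0 : ℝ) 1) (hε : 0 < ε) :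
    ∃ s : QI, ((s : ℚ) : ℝ) ≤ v ∧ v - ε ≤ ((s : ℚ) : ℝ) := by
  obtain ⟨s, h1, h2⟩ := exists_QI_ge (v := 1 - v) ⟨by linarith [hv.2], by linarith [hv.1]⟩ hε
  refine ⟨⟨1 - s, by linarith [s.2.2], by linarith [s.2.1]⟩, ?_, ?_⟩ <;> push_cast <;> linarith

theorem QI.cast_mem (r : QI) : ((r : ℚ) : ℝ) ∈ Set.Icc (0 : ℝ) 1 :=
  ⟨by exact_mod_cast r.2.1, by exact_mod_cast r.2.2⟩

theorem eq_of_forall_QI_ge_iff {a b : ℝ} (ha : a ∈ Set.Icc (0 : ℝ) 1) (hb : b ∈ Set.Icc (0 : ℝ) 1)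
    (h : ∀ r : QI, a ≤ ((r : ℚ) : ℝ) ↔ b ≤ ((r : ℚ) : ℝ)) : a = b := by
  refine le_antisymm ?_ ?_ <;> refine le_of_forall_pos_le_add fun ε hε => ?_
  · obtain ⟨s, h1, h2⟩ := exists_QI_ge hb hε
    exact ((h s).2 h1).trans h2
  · obtain ⟨s, h1, h2⟩ := exists_QI_ge ha hε
    exact ((h s).1 h1).trans h2

theorem eq_of_forall_QI_le_iff {a b : ℝ} (ha : a ∈ Set.Icc (0 : ℝ) 1) (hb : b ∈ Set.Icc (0 : ℝ) 1)
    (h : ∀ r : QI, ((r : ℚ) : ℝ) ≤ a ↔ ((r : ℚ) : ℝ) ≤ b) : a = b := by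
  refine le_antisymm ?_ ?_ <;> refine le_of_forall_pos_le_add fun ε hε => ?_
  · obtain ⟨s, h1, h2⟩ := exists_QI_le ha hε
    linarith [(h s).1 h1]
  · obtain ⟨s, h1, h2⟩ := exists_QI_le hb hε
    linarith [(h s).2 h1]

theorem le_of_forall_le_add_one_div {a b : ℝ} (h : ∀ m : ℕ, a ≤ b + 1 / ((m : ℝ) + 1)) : a ≤ b := by
  refine le_of_forall_pos_le_add fun ε hε => ?_
  obtain ⟨m, hm⟩ := exists_nat_one_div_lt hε
  linarith [h m]

theorem one_div_pos_nat (m : ℕ) : (0 : ℝ) < 1 / ((m : ℝ) + 1) := Nat.one_div_pos_of_nat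

/-- The condition is $a\le r+b$, with `b` replaced by rationals approaching it from below. -/
theorem monus_le_iff {a b : ℝ} (hb : b ∈ Set.Icc (0 : ℝ) 1) {r : ℝ} (hr : 0 ≤ r) :
    max (a - b) 0 ≤ r ↔ ∀ m : ℕ, ∃ s : QI, ((s : ℚ) : ℝ) ≤ b ∧
      a ≤ r + ((s : ℚ) : ℝ) + 1 / ((m : ℝ) + 1) := by
  refine ⟨fun h m => ?_, fun h => max_le (le_of_forall_le_add_one_div fun m => ?_) hr⟩
  · obtain ⟨s, h1, h2⟩ := exists_QI_le hb (one_div_pos_nat m)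
    exact ⟨s, h1, by linarith [le_max_left (a - b) 0]⟩
  · obtain ⟨s, h1, h2⟩ := h m
    linarith

/-- Positivity of `r` removes the truncation: at $r=0$ the left side always holds, while the right
side says $b\le a$. -/
theorem le_monus_iff {a b : ℝ} (hb : b ∈ Set.Icc (0 : ℝ) 1) {r : ℝ} (hr : 0 < r) :
    r ≤ max (a - b) 0 ↔ ∀ m : ℕ, ∃ s : QI, b ≤ ((s : ℚ) : ℝ) ∧
      r + ((s : ℚ) : ℝ) - 1 / ((m : ℝ) + 1) ≤ a := by
  rw [le_max_iff, or_iff_left (not_le.2 hr)]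
  refine ⟨fun h m => ?_, fun h => le_of_forall_le_add_one_div fun m => ?_⟩
  · obtain ⟨s, h1, h2⟩ := exists_QI_ge hb (one_div_pos_nat m)
    exact ⟨s, h1, by linarith⟩
  · obtain ⟨s, h1, h2⟩ := h m
    linarith

end Rationals

open FirstOrder.Language (Structure)

/-! ### Metric prestructures satisfy the dense theory -/

section Realize

theorem realize_closure {L : FirstOrder.Language.{u, u}} {M : Type u} [L.Structure M] {n : ℕ}
    (σ : InfFml L n) :
    (InfFml.closure σ).Realize (M := M) Fin.elim0 ↔ ∀ x : Fin n → M, σ.Realize x := by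
  induction n with
  | zero =>
    refine ⟨fun h x => ?_, fun h => h _⟩
    rwa [Subsingleton.elim x Fin.elim0]
  | succ n ih =>
    refine (ih σ.all).trans ⟨fun h x => ?_, fun h x a => h _⟩
    have := h (Fin.init (α := fun _ => M) x) (x (Fin.last n))
    rwa [Fin.snoc_init_self] at this

variable {M : Type u} [(plus τ).Structure M]

/-- The relation symbols `R_{φ ≤ r}` and `R_{φ ≥ r}` compare the value `v φ` with `r`. -/
structure IsValuation (v : ∀ n : ℕ, τ.Fml n → (Fin n → M) → ℝ) : Prop where
  mem : ∀ {n : ℕ} (φ : τ.Fml n) (x : Fin n → M), v n φ x ∈ Set.Icc (0 : ℝ) 1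
  le_iff : ∀ {n : ℕ} (φ : τ.Fml n) (r : QI) (x : Fin n → M),
    Structure.RelMap (L := plus τ) (PlusRel.le φ r) x ↔ v n φ x ≤ ((r : ℚ) : ℝ)
  ge_iff : ∀ {n : ℕ} (φ : τ.Fml n) (r : QI) (x : Fin n → M),
    Structure.RelMap (L := plus τ) (PlusRel.ge φ r) x ↔ ((r : ℚ) : ℝ) ≤ v n φ x

namespace IsValuation

variable {v : ∀ n : ℕ, τ.Fml n → (Fin n → M) → ℝ}

theorem realize_leAt (hv : IsValuation v) {k n : ℕ} (φ : τ.Fml k) (q : ℚ) (ts : Fin k → (plus τ).Term (Fin n))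
    (x : Fin n → M) :
    (leAt φ q ts).Realize x ↔ v k φ (fun i => (ts i).realize x) ≤ (q : ℝ) := by
  obtain ⟨h0, h1⟩ := hv.mem φ fun i => (ts i).realize x
  unfold leAt
  split_ifs with h h'
  · exact hv.le_iff φ ⟨q, h⟩ _
  · have : (q : ℝ) < 0 := by exact_mod_cast h'
    simp only [InfFml.Realize, false_iff, not_le]
    linarith
  · have : (1 : ℝ) < q := by
      by_contra! hc
      exact h ⟨not_lt.1 h', by exact_mod_cast hc⟩
    simp only [InfFml.Realize, true_iff]
    linarith

theorem realize_geAt (hv : IsValuation v) {k n : ℕ} (φ : τ.Fml k) (q : ℚ) (ts : Fin k → (plus τ).Term (Fin n))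
    (x : Fin n → M) :
    (geAt φ q ts).Realize x ↔ (q : ℝ) ≤ v k φ fun i => (ts i).realize x := by
  obtain ⟨h0, h1⟩ := hv.mem φ fun i => (ts i).realize x
  unfold geAt
  split_ifs with h h'
  · exact hv.ge_iff φ ⟨q, h⟩ _
  · have : (q : ℝ) < 0 := by exact_mod_cast h'
    simp only [InfFml.Realize, true_iff]
    linarith
  · have : (1 : ℝ) < q := by
      by_contra! hc
      exact h ⟨not_lt.1 h', by exact_mod_cast hc⟩
    simp only [InfFml.Realize, false_iff, not_le]
    linarith

theorem realize_le (hv : IsValuation v) {n : ℕ} (φ : τ.Fml n) (q : ℚ) (x : Fin n → M) :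
    (le φ q).Realize x ↔ v n φ x ≤ (q : ℝ) :=
  hv.realize_leAt φ q _ x

theorem realize_ge (hv : IsValuation v) {n : ℕ} (φ : τ.Fml n) (q : ℚ) (x : Fin n → M) :
    (ge φ q).Realize x ↔ (q : ℝ) ≤ v n φ x :=
  hv.realize_geAt φ q _ x

end IsValuation

theorem realize_pair {n : ℕ} (s t : (plus τ).Term (Fin n)) (x : Fin n → M) :
    (fun i => (![s, t] i).realize x) = ![s.realize x, t.realize x] := by
  funext i
  fin_cases i <;> rfl

theorem realize_append {n k l : ℕ} (s : Fin k → (plus τ).Term (Fin n))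
    (t : Fin l → (plus τ).Term (Fin n)) (x : Fin n → M) :
    (fun i => (Fin.append s t i).realize x) =
      Fin.append (fun i => (s i).realize x) fun i => (t i).realize x := by
  funext i
  refine Fin.addCases (fun j => ?_) (fun j => ?_) i <;> simp

/-- The `τ⁺`-structure on `M` is induced by the continuous structure on `M`. -/
structure IsPlus (τ : Lang.{u}) (M : Type u) [PseudoMetricSpace M] [PreStructure τ M]
    [(plus τ).Structure M] : Prop where
  funMap_eq : ∀ {n : ℕ} (f : τ.Functions n) (x : Fin n → M),
    Structure.funMap (L := plus τ) f x = PreStructure.funMap f x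
  isValuation : IsValuation fun (n : ℕ) (φ : τ.Fml n) (x : Fin n → M) => peval φ x

/-- The `τ⁺`-structure induced by a continuous structure. -/
@[reducible] def plusStructure (τ : Lang.{u}) (M : Type u) [PseudoMetricSpace M]
    [PreStructure τ M] : (plus τ).Structure M where
  funMap := fun {_} f x => PreStructure.funMap (τ := τ) f x
  RelMap := fun {_} R x => match R with
    | .le φ r => peval φ x ≤ ((r : ℚ) : ℝ)
    | .ge φ r => ((r : ℚ) : ℝ) ≤ peval φ x

theorem isPlus_plusStructure {M : Type u} [PseudoMetricSpace M] [PreStructure τ M] :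
    @IsPlus τ M _ _ (plusStructure τ M) :=
  @IsPlus.mk τ M _ _ (plusStructure τ M) (fun _ _ => rfl)
    (@IsValuation.mk τ M (plusStructure τ M) _ peval_mem (fun _ _ _ => Iff.rfl)
      fun _ _ _ => Iff.rfl)

theorem IsPlus.realize_onTerm [PseudoMetricSpace M] [PreStructure τ M] (hM : IsPlus τ M) {n : ℕ} (t : τ.Term n) (x : Fin n → M) :
    ((toPlus τ).onTerm t).realize x = tval x t := by
  induction t with
  | var i => rfl
  | func f ts ih => exact (hM.funMap_eq f _).trans (congrArg _ (funext ih))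

theorem peval_dFml {M : Type u} [PseudoMetricSpace M] [PreStructure τ M] (x y : M) : peval (dFml τ) ![x, y] = dist x y := by
  simp [dFml, peval, tval]

theorem peval_relDiff {M : Type u} [PseudoMetricSpace M] [PreStructure τ M] {k : ℕ} (R : τ.Relations k) (x y : Fin k → M) :
    peval (relDiff R) (Fin.append x y) =
      max (PreStructure.relMap R x - PreStructure.relMap R y) 0 := by
  simp only [relDiff, peval, tval, Fin.append_left, Fin.append_right]

/-- A continuous structure on a metric space, possibly incomplete, is a model of `T_dense`. -/
theorem IsPlus.realize_Tdense [MetricSpace M] [PreStructure τ M] (hM : IsPlus τ M) :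
    ∀ σ ∈ Tdense τ, σ.Realize (M := M) Fin.elim0 := by
  have hv := hM.isValuation
  have hdist : ∀ {n : ℕ} (s t : (plus τ).Term (Fin n)) (x : Fin n → M),
      peval (dFml τ) (fun i => (![s, t] i).realize x) = dist (s.realize x) (t.realize x) :=
    fun s t x => by rw [realize_pair, peval_dFml]
  intro σ hσ
  cases hσ with
  | not_ge φ r =>
    simp only [realize_closure, InfFml.Realize, hv.realize_le, hv.realize_ge, not_le]
    exact fun x => le_of_lt
  | not_le φ r =>
    simp only [realize_closure, InfFml.Realize, hv.realize_le, hv.realize_ge, not_le]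
    exact fun x => le_of_lt
  | not_both φ r s h =>
    simp only [realize_closure, InfFml.Realize, hv.realize_le, hv.realize_ge, not_le]
    have h' : ((s : ℚ) : ℝ) < ((r : ℚ) : ℝ) := by exact_mod_cast h
    exact fun x => (lt_or_ge _ _).imp_right fun h => h'.trans_le h
  | le_mono φ r s h =>
    simp only [realize_closure, InfFml.Realize, hv.realize_le]
    have h' : ((s : ℚ) : ℝ) ≤ ((r : ℚ) : ℝ) := by exact_mod_cast h
    exact fun x hx => hx.trans h'
  | ge_mono φ r s h =>
    simp only [realize_closure, InfFml.Realize, hv.realize_ge]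
    have h' : ((s : ℚ) : ℝ) ≤ ((r : ℚ) : ℝ) := by exact_mod_cast h
    exact fun x hx => h'.trans hx
  | total φ r =>
    simp only [realize_closure, InfFml.Realize, hv.realize_le, hv.realize_ge]
    exact fun x => le_total _ _
  | value φ =>
    simp only [realize_closure, InfFml.Realize, hv.realize_le, hv.realize_ge]
    intro x m
    have hm := one_div_pos_nat m
    -- Errors of a quarter on each side leave a gap of at most half the bound, which gives the
    -- strict inequality.
    obtain ⟨s, h1, h2⟩ := exists_QI_ge (peval_mem φ x) (half_pos (half_pos hm))
    obtain ⟨t, h3, h4⟩ := exists_QI_le (peval_mem φ x) (half_pos (half_pos hm))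
    refine ⟨⟨(s, t), ?_⟩, h1, h3⟩
    have : |((s : ℚ) : ℝ) - ((t : ℚ) : ℝ)| < 1 / ((m : ℝ) + 1) := by
      rw [abs_lt]
      constructor <;> linarith
    rw [← Rat.cast_lt (K := ℝ)]
    push_cast
    exact this
  | ge_closed φ r =>
    simp only [realize_closure, InfFml.Realize, hv.realize_ge]
    push_cast
    exact fun x h => le_of_forall_le_add_one_div fun m => by linarith [h m]
  | le_closed φ r =>
    simp only [realize_closure, InfFml.Realize, hv.realize_le]
    push_cast
    exact fun x h => le_of_forall_le_add_one_div h
  | bounds φ =>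
    simp only [realize_closure, InfFml.Realize, hv.realize_le, hv.realize_ge]
    push_cast
    exact fun x => peval_mem φ x
  | zero_one t h =>
    simp only [realize_closure, InfFml.Realize, hv.realize_le, hv.realize_ge, peval]
    push_cast
    have h' : (0 : ℝ) < ((t : ℚ) : ℝ) := by exact_mod_cast h
    exact fun x => ⟨not_le.2 h', by linarith⟩
  | half_ge φ r =>
    simp only [realize_closure, InfFml.Realize, InfFml.iff, hv.realize_ge, peval]
    push_cast
    exact fun x => ⟨fun h => by linarith, fun h => by linarith⟩
  | half_le φ r =>
    simp only [realize_closure, InfFml.Realize, InfFml.iff, hv.realize_le, peval]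
    push_cast
    exact fun x => ⟨fun h => by linarith, fun h => by linarith⟩
  | monus_ge φ ψ r h =>
    simp only [realize_closure, InfFml.Realize, InfFml.iff, hv.realize_le, hv.realize_ge, peval]
    push_cast
    have h' : (0 : ℝ) < ((r : ℚ) : ℝ) := by exact_mod_cast h
    exact fun x => iff_iff_implies_and_implies.1 (le_monus_iff (peval_mem ψ x) h')
  | monus_le φ ψ r =>
    simp only [realize_closure, InfFml.Realize, InfFml.iff, hv.realize_le, hv.realize_ge, peval]
    push_cast
    exact fun x => iff_iff_implies_and_implies.1 (monus_le_iff (peval_mem ψ x) r.cast_mem.1)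
  | sup_le φ r =>
    simp only [realize_closure, InfFml.Realize, InfFml.iff, hv.realize_le]
    exact fun x => iff_iff_implies_and_implies.1 (peval_sup_le_iff φ x _)
  | sup_ge φ r =>
    simp only [realize_closure, InfFml.Realize, InfFml.iff, hv.realize_ge]
    push_cast
    refine fun x => ⟨fun h m => ?_, fun h => le_of_forall_le_add_one_div fun m => ?_⟩
    · obtain ⟨a, ha⟩ := exists_lt_of_lt_peval_sup
        ((sub_lt_self _ (one_div_pos_nat m)).trans_le h)
      exact ⟨a, ha.le⟩
    · obtain ⟨a, ha⟩ := h m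
      linarith [peval_le_sup φ x a]
  | inf_le φ r =>
    simp only [realize_closure, InfFml.Realize, InfFml.iff, hv.realize_le]
    push_cast
    refine fun x => ⟨fun h m => ?_, fun h => le_of_forall_le_add_one_div fun m => ?_⟩
    · obtain ⟨a, ha⟩ := exists_lt_of_peval_inf_lt
        (h.trans_lt (lt_add_of_pos_right _ (one_div_pos_nat m)))
      exact ⟨a, ha.le⟩
    · obtain ⟨a, ha⟩ := h m
      linarith [peval_inf_le φ x a]
  | inf_ge φ r =>
    simp only [realize_closure, InfFml.Realize, InfFml.iff, hv.realize_ge]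
    exact fun x => iff_iff_implies_and_implies.1 (le_peval_inf_iff φ x _)
  | subst_le φ ts r =>
    simp only [realize_closure, InfFml.Realize, InfFml.iff, hv.realize_le, hv.realize_leAt,
      hM.realize_onTerm, peval_subst]
    exact fun x => ⟨id, id⟩
  | subst_ge φ ts r =>
    simp only [realize_closure, InfFml.Realize, InfFml.iff, hv.realize_ge, hv.realize_geAt,
      hM.realize_onTerm, peval_subst]
    exact fun x => ⟨id, id⟩
  | dist_zero =>
    simp only [realize_closure, InfFml.Realize, InfFml.iff, hv.realize_leAt, hdist]
    push_cast
    exact fun x => iff_iff_implies_and_implies.1 dist_le_zero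
  | dist_symm_le r =>
    simp only [realize_closure, InfFml.Realize, InfFml.iff, hv.realize_leAt, hdist]
    exact fun x => iff_iff_implies_and_implies.1 (by rw [dist_comm])
  | dist_symm_ge r =>
    simp only [realize_closure, InfFml.Realize, InfFml.iff, hv.realize_geAt, hdist]
    exact fun x => iff_iff_implies_and_implies.1 (by rw [dist_comm])
  | dist_triangle =>
    simp only [realize_closure, InfFml.Realize, hv.realize_geAt, hdist]
    push_cast
    intro x r hr a m
    simp only [FirstOrder.Language.Term.realize] at hr ⊢
    have e0 : Fin.snoc (α := fun _ => M) x a 0 = x 0 :=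
      Fin.snoc_castSucc (α := fun _ => M) a x 0
    have e1 : Fin.snoc (α := fun _ => M) x a 1 = x 1 :=
      Fin.snoc_castSucc (α := fun _ => M) a x 1
    have e2 : Fin.snoc (α := fun _ => M) x a 2 = a := Fin.snoc_last (α := fun _ => M) a x
    rw [e0, e1, e2]
    have hm := one_div_pos_nat m
    have htri := dist_triangle (x 0) a (x 1)
    -- The axiom asks for $s\le r$, so the distance is first cut off at `r`. If the cut-off is
    -- effective, $r-s-1/(m+1)\le0$ and the second conjunct is trivial; otherwise it is the triangle
    -- inequality.
    obtain ⟨s, h1, h2⟩ := exists_QI_le (v := min ((r : ℚ) : ℝ) (dist (x 0) a))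
      ⟨le_min r.cast_mem.1 dist_nonneg, (min_le_left _ _).trans r.cast_mem.2⟩ hm
    have h3 : s ≤ r := by exact_mod_cast h1.trans (min_le_left _ _)
    refine ⟨⟨s, h3⟩, h1.trans (min_le_right _ _), ?_⟩
    rcases min_choice ((r : ℚ) : ℝ) (dist (x 0) a) with h | h <;> rw [h] at h2
    · linarith [dist_nonneg (x := a) (y := x 1)]
    · linarith
  | fun_unif f ε hε r s hr hs =>
    simp only [realize_closure, InfFml.Realize, InfFml.conjFin, hv.realize_leAt, hdist]
    intro x h
    have key := PreStructure.funMap_unif (M := M) f ε hε (fun i => x (Fin.castAdd _ i))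
      (fun i => x (Fin.natAdd _ i)) fun i => (h i).trans_lt hs
    rw [← hM.funMap_eq, ← hM.funMap_eq] at key
    exact key.trans hr
  | rel_unif R ε hε r s hr hs =>
    simp only [realize_closure, InfFml.Realize, InfFml.conjFin, hv.realize_leAt, hdist,
      realize_append, peval_relDiff]
    intro x h
    have key := abs_le.1 (PreStructure.relMap_unif (M := M) R ε hε (fun i => x (Fin.castAdd _ i))
      (fun i => x (Fin.natAdd _ i)) fun i => (h i).trans_lt hs)
    have h0 := r.cast_mem.1
    exact ⟨max_le (by simp only [FirstOrder.Language.Term.realize]; linarith) h0,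
      max_le (by simp only [FirstOrder.Language.Term.realize]; linarith) h0⟩

end Realize

/-! ### Recovering the metric structure from a discrete model -/

section Recover

variable {M : Type u} [(plus τ).Structure M]

/-- The value of a formula in a model of `T_dense`. -/
noncomputable def plusVal (τ : Lang.{u}) (M : Type u) [(plus τ).Structure M] (n : ℕ)
    (φ : τ.Fml n) (x : Fin n → M) : ℝ :=
  sSup {a : ℝ | ∃ q : QI, ((q : ℚ) : ℝ) = a ∧ Structure.RelMap (L := plus τ) (PlusRel.ge φ q) x}

theorem realize_le_QI {n : ℕ} (φ : τ.Fml n) (r : QI) (x : Fin n → M) :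
    (le φ r).Realize x ↔ Structure.RelMap (L := plus τ) (PlusRel.le φ r) x := by
  unfold le leAt
  rw [dif_pos r.2]
  exact Iff.rfl

theorem realize_ge_QI {n : ℕ} (φ : τ.Fml n) (r : QI) (x : Fin n → M) :
    (ge φ r).Realize x ↔ Structure.RelMap (L := plus τ) (PlusRel.ge φ r) x := by
  unfold ge geAt
  rw [dif_pos r.2]
  exact Iff.rfl

/-- Monotonicity makes the set of $q$ with $R_{\phi\ge q}$ an initial segment, `ge_closed` adds its
endpoint, and `not_both`, `not_ge` and `le_closed` tie $R_{\phi\le r}$ to the same cut. -/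
theorem isValuation_plusVal (h : ∀ σ ∈ Tdense τ, σ.Realize (M := M) Fin.elim0) :
    IsValuation (plusVal τ M) := by
  have val_bdd : ∀ {n : ℕ} (φ : τ.Fml n) (x : Fin n → M),
      BddAbove {a : ℝ | ∃ q : QI, ((q : ℚ) : ℝ) = a ∧
        Structure.RelMap (L := plus τ) (PlusRel.ge φ q) x} := fun φ x =>
    ⟨1, by rintro _ ⟨q, rfl, -⟩; exact q.cast_mem.2⟩
  have ge_zero : ∀ {n : ℕ} (φ : τ.Fml n) (x : Fin n → M),
      Structure.RelMap (L := plus τ) (PlusRel.ge φ ⟨0, le_rfl, zero_le_one⟩) x := fun φ x =>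
    (realize_ge_QI φ ⟨0, le_rfl, zero_le_one⟩ x).1 ((realize_closure _).1 (h _ (.bounds φ)) x).1
  have val_ne : ∀ {n : ℕ} (φ : τ.Fml n) (x : Fin n → M),
      {a : ℝ | ∃ q : QI, ((q : ℚ) : ℝ) = a ∧
        Structure.RelMap (L := plus τ) (PlusRel.ge φ q) x}.Nonempty := fun φ x =>
    ⟨_, _, rfl, ge_zero φ x⟩
  have ge_mono : ∀ {n : ℕ} (φ : τ.Fml n) (x : Fin n → M) (r s : QI), (s : ℚ) ≤ r →
      Structure.RelMap (L := plus τ) (PlusRel.ge φ r) x →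
      Structure.RelMap (L := plus τ) (PlusRel.ge φ s) x := fun φ x r s hsr hr =>
    (realize_ge_QI φ s x).1 ((realize_closure _).1 (h _ (.ge_mono φ r s hsr)) x
      ((realize_ge_QI φ r x).2 hr))
  have le_val : ∀ {n : ℕ} (φ : τ.Fml n) (x : Fin n → M) (r : QI),
      Structure.RelMap (L := plus τ) (PlusRel.ge φ r) x →
      ((r : ℚ) : ℝ) ≤ plusVal τ M n φ x := fun φ x r hr =>
    le_csSup (val_bdd φ x) ⟨r, rfl, hr⟩
  have of_lt : ∀ {n : ℕ} (φ : τ.Fml n) (x : Fin n → M) (r : QI),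
      ((r : ℚ) : ℝ) < plusVal τ M n φ x →
      Structure.RelMap (L := plus τ) (PlusRel.ge φ r) x := fun φ x r hr => by
    obtain ⟨_, ⟨q, rfl, hq⟩, hrq⟩ := exists_lt_of_lt_csSup (val_ne φ x) hr
    exact ge_mono φ x q r (by exact_mod_cast hrq.le) hq
  refine ⟨fun φ x => ⟨?_, ?_⟩, fun φ r x => ⟨fun hr => ?_, fun hr => ?_⟩,
    fun φ r x => ⟨le_val φ x r, fun hr => ?_⟩⟩
  · simpa using le_val φ x _ (ge_zero φ x)
  · exact csSup_le (val_ne φ x) (by rintro _ ⟨q, rfl, -⟩; exact q.cast_mem.2)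
  · refine csSup_le (val_ne φ x) ?_
    rintro _ ⟨q, rfl, hq⟩
    by_contra! hc
    rcases (realize_closure _).1 (h _ (.not_both φ q r (by exact_mod_cast hc))) x with h1 | h1
    · exact h1 ((realize_ge_QI φ q x).2 hq)
    · exact h1 ((realize_le_QI φ r x).2 hr)
  · refine (realize_le_QI φ r x).1 ((realize_closure _).1 (h _ (.le_closed φ r)) x fun m => ?_)
    have hm : (0 : ℚ) < 1 / (m + 1) := Nat.one_div_pos_of_nat
    -- Beyond $1$ there is no relation symbol, and the formula is true by convention.
    by_cases h1 : (r : ℚ) + 1 / (m + 1) ≤ 1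
    · have h2 : (r : ℚ) + 1 / (m + 1) ∈ Set.Icc (0 : ℚ) 1 := ⟨by linarith [r.2.1], h1⟩
      refine (realize_closure _).1 (h _ (.not_ge φ ⟨_, h2⟩)) x fun h3 => ?_
      have h4 := le_val φ x _ ((realize_ge_QI φ ⟨_, h2⟩ x).1 h3)
      have h5 : ((r : ℚ) : ℝ) < (((r : ℚ) + 1 / (m + 1) : ℚ) : ℝ) := by
        exact_mod_cast lt_add_of_pos_right _ hm
      exact absurd (h4.trans hr) (not_le.2 h5)
    · show (le φ ((r : ℚ) + 1 / (m + 1))).Realize x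
      unfold le leAt
      rw [dif_neg fun h2 => h1 h2.2, if_neg (not_lt.2 (by linarith [r.2.1]))]
      trivial
  · refine (realize_ge_QI φ r x).1 ((realize_closure _).1 (h _ (.ge_closed φ r)) x fun m => ?_)
    have hm : (0 : ℚ) < 1 / (m + 1) := Nat.one_div_pos_of_nat
    by_cases h1 : 0 ≤ (r : ℚ) - 1 / (m + 1)
    · have h2 : (r : ℚ) - 1 / (m + 1) ∈ Set.Icc (0 : ℚ) 1 := ⟨h1, by linarith [r.2.2]⟩
      refine (realize_ge_QI φ ⟨_, h2⟩ x).2 (of_lt φ x _ (lt_of_lt_of_le ?_ hr))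
      exact_mod_cast sub_lt_self _ hm
    · show (ge φ ((r : ℚ) - 1 / (m + 1))).Realize x
      unfold ge geAt
      rw [dif_neg fun h2 => h1 h2.1, if_pos (not_le.1 h1)]
      trivial

/-- Every nonempty model of `T_dense` comes from a continuous structure on a metric space. -/
theorem exists_isPlus [Nonempty M] (h : ∀ σ ∈ Tdense τ, σ.Realize (M := M) Fin.elim0) :
    ∃ (_ : MetricSpace M) (_ : PreStructure τ M), IsPlus τ M := by
  have hv := isValuation_plusVal h
  have hax : ∀ {n : ℕ} {σ : InfFml (plus τ) n}, IsDense τ (InfFml.closure σ) →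
      ∀ x : Fin n → M, σ.Realize x := fun hσ => (realize_closure _).1 (h _ hσ)
  let v := plusVal τ M
  let d : M → M → ℝ := fun x y => v 2 (dFml τ) ![x, y]
  have hpair : ∀ {n : ℕ} (s t : (plus τ).Term (Fin n)) (x : Fin n → M),
      plusVal τ M 2 (dFml τ) (fun i => (![s, t] i).realize x) = d (s.realize x) (t.realize x) :=
    fun s t x => by rw [realize_pair]
  have v_subst : ∀ {n k : ℕ} (φ : τ.Fml k) (ts : Fin k → τ.Term n) (x : Fin n → M),
      v n (φ.subst ts) x = v k φ fun i => ((toPlus τ).onTerm (ts i)).realize x := by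
    intro n k φ ts x
    refine eq_of_forall_QI_ge_iff (hv.mem _ _) (hv.mem _ _) fun r => ?_
    have := hax (.subst_le φ ts r) x
    simp only [InfFml.iff, InfFml.Realize, hv.realize_le, hv.realize_leAt] at this
    exact ⟨this.2, this.1⟩
  have v_monus : ∀ {n : ℕ} (φ ψ : τ.Fml n) (x : Fin n → M),
      v n (.monus φ ψ) x = max (v n φ x - v n ψ x) 0 := by
    intro n φ ψ x
    have h1 := hv.mem φ x
    have h2 := hv.mem ψ x
    refine eq_of_forall_QI_ge_iff (hv.mem _ _)
      ⟨le_max_right _ _, max_le (by linarith [h1.2, h2.1]) zero_le_one⟩ fun r => ?_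
    rw [monus_le_iff h2 r.cast_mem.1]
    have := hax (.monus_le φ ψ r) x
    simp only [InfFml.iff, InfFml.Realize, hv.realize_le, hv.realize_ge] at this
    push_cast at this
    exact ⟨this.1, this.2⟩
  have d_self : ∀ x y : M, d x y ≤ 0 ↔ x = y := by
    intro x y
    have := hax .dist_zero ![x, y]
    simp only [InfFml.iff, InfFml.Realize, hv.realize_leAt, hpair] at this
    push_cast at this
    exact ⟨this.1, this.2⟩
  have d_comm : ∀ x y : M, d x y = d y x := by
    intro x y
    refine eq_of_forall_QI_ge_iff (hv.mem _ _) (hv.mem _ _) fun r => ?_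
    have := hax (.dist_symm_le r) ![x, y]
    simp only [InfFml.iff, InfFml.Realize, hv.realize_leAt, hpair] at this
    exact ⟨this.1, this.2⟩
  have d_triangle : ∀ x y z : M, d x z ≤ d x y + d y z := by
    intro x y z
    refine le_of_forall_pos_le_add fun ε hε => ?_
    obtain ⟨r, h1, h2⟩ := exists_QI_le (hv.mem (dFml τ) ![x, z]) hε
    have := hax .dist_triangle ![x, z] r
    simp only [InfFml.Realize, hv.realize_geAt, hpair] at this
    push_cast at this
    have h3 := this h1 y
    have h4 : ((r : ℚ) : ℝ) ≤ d x y + d y z := le_of_forall_le_add_one_div fun m => by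
      obtain ⟨s, h5, h6⟩ := h3 m
      have h5 : ((s : ℚ) : ℝ) ≤ d x y := h5
      have h6 : ((r : ℚ) : ℝ) - ((s : ℚ) : ℝ) - 1 / ((m : ℝ) + 1) ≤ d y z := h6
      linarith
    have h2 : d x z - ε ≤ ((r : ℚ) : ℝ) := h2
    linarith
  let inst : MetricSpace M :=
    { dist := d
      dist_self := fun x => le_antisymm ((d_self x x).2 rfl) (hv.mem _ _).1
      dist_comm := d_comm
      dist_triangle := d_triangle
      eq_of_dist_eq_zero := fun {x y} hxy => (d_self x y).1 (le_of_eq hxy) }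
  -- The axioms bound all distances by one rational below the modulus; it is found between the
  -- maximal distance and `δ`.
  have exists_s : ∀ {k : ℕ} {x y : Fin k → M} {δ : ℝ}, 0 < δ → (∀ i, dist (x i) (y i) < δ) →
      ∃ s : QI, ((s : ℚ) : ℝ) < δ ∧ ∀ i, d (x i) (y i) ≤ ((s : ℚ) : ℝ) := by
    intro k x y δ hδ hxy
    have h1 := (dist_pi_lt_iff hδ).2 hxy
    have h2 : dist x y ≤ 1 := (dist_pi_le_iff zero_le_one).2 fun i => (hv.mem _ _).2
    obtain ⟨s, h3, h4⟩ := exists_QI_ge (v := dist x y) ⟨dist_nonneg, h2⟩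
      (half_pos (sub_pos.2 h1))
    exact ⟨s, by linarith, fun i => (dist_le_pi_dist x y i).trans h3⟩
  let inst' : PreStructure τ M :=
    { nonempty := inferInstance
      dist_le_one := fun x y => (hv.mem _ _).2
      funMap := fun {n} f x => Structure.funMap (L := plus τ) (n := n) f x
      relMap := fun {n} R x => v n (.rel R .var) x
      relMap_mem := fun R x => hv.mem _ _
      funMap_unif := fun {k} f ε hε x y hxy => by
        obtain ⟨s, h1, h2⟩ := exists_s (τ.funMod_mem f ε hε).1 hxy
        refine le_of_forall_pos_le_add fun η hη => ?_
        -- The real `ε` may be irrational, so the axiom is used at rationals `r` decreasing to it.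
        obtain ⟨r, h3, h4⟩ := exists_QI_ge ⟨hε.1.le, hε.2⟩ hη
        have := hax (.fun_unif f ε hε r s h3 h1) (Fin.append x y)
        simp only [InfFml.conjFin, InfFml.Realize, hv.realize_leAt, hpair,
          FirstOrder.Language.Term.realize, Fin.append_left, Fin.append_right] at this
        exact (this h2).trans h4
      relMap_unif := fun {k} R ε hε x y hxy => by
        -- The predicate is defined through the atomic formula $R(\mathbf x)$; `relDiff R` is a
        -- truncated difference of two substitution instances of it.
        have hR : ∀ z w : Fin k → M, v (k + k) (relDiff R) (Fin.append z w) =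
            max (v k (.rel R .var) z - v k (.rel R .var) w) 0 := by
          intro z w
          have e1 := v_subst (.rel R .var) (fun i => .var (Fin.castAdd k i)) (Fin.append z w)
          have e2 := v_subst (.rel R .var) (fun i => .var (Fin.natAdd k i)) (Fin.append z w)
          simp only [FirstOrder.Language.LHom.onTerm, FirstOrder.Language.Term.realize,
            Fin.append_left, Fin.append_right] at e1 e2
          rw [← e1, ← e2]
          exact v_monus _ _ _
        obtain ⟨s, h1, h2⟩ := exists_s (τ.relMod_mem R ε hε).1 hxy
        refine le_of_forall_pos_le_add fun η hη => ?_
        obtain ⟨r, h3, h4⟩ := exists_QI_ge ⟨hε.1.le, hε.2⟩ hη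
        have := hax (.rel_unif R ε hε r s h3 h1) (Fin.append x y)
        simp only [InfFml.conjFin, InfFml.Realize, hv.realize_leAt, hpair, realize_append,
          FirstOrder.Language.Term.realize, Fin.append_left, Fin.append_right] at this
        obtain ⟨h5, h6⟩ := this h2
        have h5 := (hR x y).symm.trans_le h5
        have h6 := (hR y x).symm.trans_le h6
        exact abs_sub_le_iff.2 ⟨((le_max_left _ _).trans h5).trans h4,
          ((le_max_left _ _).trans h6).trans h4⟩ }
  have hterm : ∀ {n : ℕ} (t : τ.Term n) (x : Fin n → M),
      ((toPlus τ).onTerm t).realize x = tval x t := by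
    intro n t x
    induction t with
    | var i => rfl
    | func f ts ih =>
      exact congrArg (fun y => Structure.funMap (L := plus τ) (M := M) f y) (funext ih)
  have hpv : ∀ {n : ℕ} (φ : τ.Fml n) (x : Fin n → M), peval φ x = v n φ x := by
    intro n φ x
    induction φ with
    | rel R ts =>
      have := v_subst (.rel R .var) ts x
      simp only [hterm] at this
      exact this.symm
    | dist s t =>
      have := v_subst (dFml τ) ![s, t] x
      simp only [hterm] at this
      refine Eq.trans ?_ this.symm
      refine congrArg (v 2 (dFml τ)) (funext fun i => ?_)
      fin_cases i <;> rfl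
    | @zero n =>
      refine le_antisymm (hv.mem _ _).1 (le_of_forall_pos_le_add fun ε hε => ?_)
      obtain ⟨t, h1, h2⟩ := exists_QI_le (hv.mem (.zero : τ.Fml n) x) hε
      by_cases h3 : 0 < t
      · have := (hax (.zero_one t h3) x).1
        simp only [InfFml.Realize, hv.realize_ge] at this
        exact absurd h1 this
      · have h4 : ((t : ℚ) : ℝ) ≤ 0 := by exact_mod_cast not_lt.1 h3
        simp only [peval]
        linarith
    | @one n =>
      refine le_antisymm (le_of_forall_pos_le_add fun ε hε => ?_) (hv.mem _ _).2
      obtain ⟨t, h1, h2⟩ := exists_QI_le (v := 1 - v n .one x)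
        ⟨by linarith [(hv.mem (.one : τ.Fml n) x).2], by linarith [(hv.mem (.one : τ.Fml n) x).1]⟩ hε
      by_cases h3 : 0 < t
      · have := (hax (.zero_one t h3) x).2
        simp only [InfFml.Realize, hv.realize_le] at this
        push_cast at this
        exact absurd (show v n .one x ≤ 1 - ((t : ℚ) : ℝ) by linarith) this
      · have h4 : ((t : ℚ) : ℝ) ≤ 0 := by exact_mod_cast not_lt.1 h3
        simp only [peval]
        linarith
    | half φ ih =>
      refine eq_of_forall_QI_ge_iff (peval_mem _ _) (hv.mem _ _) fun r => ?_
      have := hax (.half_le φ r) x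
      simp only [InfFml.iff, InfFml.Realize, hv.realize_le] at this
      push_cast at this
      simp only [peval, ih]
      refine Iff.trans ?_ ⟨this.2, this.1⟩
      show v _ φ x / 2 ≤ _ ↔ v _ φ x ≤ _
      constructor <;> intro <;> linarith
    | monus φ ψ ih ih' => simp only [peval, ih, ih', v_monus]
    | sup φ ih =>
      refine eq_of_forall_QI_ge_iff (peval_mem _ _) (hv.mem _ _) fun r => ?_
      have := hax (.sup_le φ r) x
      simp only [InfFml.iff, InfFml.Realize, hv.realize_le] at this
      simp only [peval_sup_le_iff, ih]
      exact ⟨this.2, this.1⟩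
    | inf φ ih =>
      -- Infima are tested from below and suprema from above, because those are the axioms with a
      -- plain universal quantifier.
      refine eq_of_forall_QI_le_iff (peval_mem _ _) (hv.mem _ _) fun r => ?_
      have := hax (.inf_ge φ r) x
      simp only [InfFml.iff, InfFml.Realize, hv.realize_ge] at this
      simp only [le_peval_inf_iff, ih]
      exact ⟨this.2, this.1⟩
  refine ⟨inst, inst', fun f x => rfl, ?_⟩
  simp only [hpv]
  exact hv

end Recover

/-! ### Embeddings are elementary maps -/

section Embeddings

variable {M N : Type u} [(plus τ).Structure M] [(plus τ).Structure N]

/-- Each cut $\phi\le r$ is an atomic relation, so preserving and reflecting atomic relations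
already fixes the values of all formulas, quantified ones included. -/
theorem IsPlus.isElem_embedding [PseudoMetricSpace M] [PreStructure τ M] [PseudoMetricSpace N]
    [PreStructure τ N] (hM : IsPlus τ M) (hN : IsPlus τ N) (f : M ↪[plus τ] N) :
    IsElem τ f := by
  intro n φ x
  refine eq_of_forall_QI_ge_iff (peval_mem _ _) (peval_mem _ _) fun r => ?_
  exact ((hN.isValuation.le_iff φ r _).symm.trans (f.map_rel _ _)).trans
    (hM.isValuation.le_iff φ r _)

/-- The formula $d(x_n,F(x_0,\dots,x_{n-1}))$ vanishes on the graph of `F`, and in a metric space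
distance $0$ is equality. -/
theorem IsElem.map_funMap {M N : Type u} [PseudoMetricSpace M] [PreStructure τ M] [MetricSpace N]
    [PreStructure τ N] {f : M → N} (hf : IsElem τ f) {n : ℕ} (F : τ.Functions n) (x : Fin n → M) :
    f (PreStructure.funMap F x) = PreStructure.funMap F fun i => f (x i) := by
  have := hf (n + 1) (.dist (.var (Fin.last n)) (.func F fun i => .var i.castSucc))
    (Fin.snoc (α := fun _ => M) x (PreStructure.funMap F x))
  simp only [peval, tval, Fin.snoc_last, Fin.snoc_castSucc, dist_self] at this
  exact eq_of_dist_eq_zero this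

/-- Elementary maps are `τ⁺`-embeddings. -/
def IsElem.embedding [MetricSpace M] [PreStructure τ M] [MetricSpace N] [PreStructure τ N]
    (hM : IsPlus τ M) (hN : IsPlus τ N) {f : M → N} (hf : IsElem τ f) : M ↪[plus τ] N where
  toFun := f
  inj' x y hxy := eq_of_dist_eq_zero (by rw [← hf.dist_eq, hxy, dist_self])
  map_fun' F x := by
    exact (congrArg f (hM.funMap_eq F x)).trans
      ((hf.map_funMap F x).trans (hN.funMap_eq F _).symm)
  map_rel' R x := by
    cases R with
    | le φ r =>
      rw [hM.isValuation.le_iff, hN.isValuation.le_iff]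
      exact (congrArg (· ≤ _) (hf _ φ x)).to_iff
    | ge φ r =>
      rw [hM.isValuation.ge_iff, hN.isValuation.ge_iff]
      exact (congrArg (_ ≤ ·) (hf _ φ x)).to_iff

theorem IsPlus.mod_Tstar_iff [MetricSpace M] [PreStructure τ M] (hM : IsPlus τ M)
    {T : Set (τ.Fml 0)} :
    Mod (Tstar T) M inferInstance ↔ ∀ φ ∈ T, peval (M := M) φ Fin.elim0 = 0 := by
  have key : ∀ φ : τ.Fml 0, (le φ 0).Realize (M := M) Fin.elim0 ↔
      peval (M := M) φ Fin.elim0 = 0 := fun φ => by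
    rw [hM.isValuation.realize_le]
    push_cast
    exact ⟨fun h => le_antisymm h (peval_mem _ _).1, le_of_eq⟩
  refine ⟨fun h φ hφ => (key φ).1 (h.2 _ (.inr ⟨φ, hφ, rfl⟩)), fun h =>
    ⟨PreStructure.nonempty τ, ?_⟩⟩
  rintro σ (hσ | ⟨φ, hφ, rfl⟩)
  · exact hM.realize_Tdense σ hσ
  · exact (key φ).2 (h φ hφ)

end Embeddings

/-! ### Galois types as sets of conditions -/

section GaloisTypes

/-- The symbol `R_{φ ≤ 0}`. -/
def leZero {n : ℕ} (φ : τ.Fml n) : (plus τ).Relations n :=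
  PlusRel.le φ ⟨0, le_rfl, zero_le_one⟩

theorem IsPlus.relMap_leZero {M : Type u} [(plus τ).Structure M] [PseudoMetricSpace M]
    [PreStructure τ M] (hM : IsPlus τ M) {n : ℕ} (φ : τ.Fml n) (x : Fin n → M) :
    Structure.RelMap (leZero φ) x ↔ peval φ x = 0 := by
  refine (hM.isValuation.le_iff φ ⟨0, le_rfl, zero_le_one⟩ x).trans ?_
  push_cast
  exact ⟨fun h => le_antisymm h (peval_mem _ _).1, le_of_eq⟩

theorem peval_closed_eq_zero_iff {M N : Type u} [PseudoMetricSpace M] [PreStructure τ M]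
    [PseudoMetricSpace N] [PreStructure τ N] {f : M → N} (hf : IsElem τ f) (φ : τ.Fml 0) :
    peval (M := N) φ Fin.elim0 = 0 ↔ peval (M := M) φ Fin.elim0 = 0 := by
  rw [← hf 0 φ Fin.elim0, Subsingleton.elim (fun i => f (Fin.elim0 i)) Fin.elim0]

variable {K : StrClass (plus τ)} {D : Type u} [(plus τ).Structure D]

/-- The conditions over `D` satisfied by the point of an extension. -/
def PointedExt.condSet (P : PointedExt K D) : Set (Cond τ D) :=
  {C | Structure.RelMap (leZero C.2.1)
    (Fin.snoc (α := fun _ => P.N) (fun i => P.emb (C.2.2 i)) P.a)}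

/-- Embeddings preserve and reflect $R_{\phi\le0}$, and the two embeddings into the amalgam agree on
`D` and on the points. So the set of conditions is an invariant of the Galois type. -/
theorem AtEquiv.condSet_eq {P Q : PointedExt K D} (h : AtEquiv K P Q) :
    P.condSet = Q.condSet := by
  obtain ⟨N, _, -, f, g, hfg, ha⟩ := h
  ext ⟨k, φ, d⟩
  refine ((f.map_rel _ _).symm.trans ?_).trans (g.map_rel _ _)
  have : (f ∘ Fin.snoc (α := fun _ => P.N) (fun i => P.emb (d i)) P.a) =
      g ∘ Fin.snoc (α := fun _ => Q.N) (fun i => Q.emb (d i)) Q.a := by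
    refine (comp_snoc_eq f _ _).trans (Eq.trans ?_ (comp_snoc_eq g _ _).symm)
    simp only [hfg, ha]
  exact Iff.of_eq (congrArg _ this)

/-- Treating the point as one more parameter `none` lets a single amalgamation identify it together
with `D`. A formula may use the point in any positions; a substitution collects these in the last
variable, and an arbitrary element of `D` fills the vacated places. -/
theorem sameType_option_elim {D M N : Type u} [PseudoMetricSpace M] [PreStructure τ M]
    [PseudoMetricSpace N] [PreStructure τ N] [Nonempty D] (f : D → M) (g : D → N) (a : M) (b : N)
    (h : ∀ C : Cond τ D, peval C.2.1 (Fin.snoc (α := fun _ => M) (fun i => f (C.2.2 i)) a) = 0 →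
      peval C.2.1 (Fin.snoc (α := fun _ => N) (fun i => g (C.2.2 i)) b) = 0) :
    SameType τ (fun o : Option D => o.elim a f) (fun o : Option D => o.elim b g) := by
  intro k φ o
  let d : Fin k → D := fun i => (o i).getD (Classical.arbitrary D)
  let σ : Fin k → τ.Term (k + 1) := fun i =>
    .var ((o i).elim (Fin.last k) fun _ => i.castSucc)
  have key : ∀ {P : Type u} [PseudoMetricSpace P] [PreStructure τ P] (r : D → P) (z : P),
      peval (φ.subst σ) (Fin.snoc (α := fun _ => P) (fun i => r (d i)) z) =
        peval φ fun i => (o i).elim z r := by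
    intro P _ _ r z
    rw [peval_subst]
    congr 1
    funext i
    rcases ho : o i with _ | x <;> simp [σ, d, tval, ho]
  have := peval_eq_of_zero_imp
    (x := Fin.snoc (α := fun _ => M) (fun i => f (d i)) a)
    (y := Fin.snoc (α := fun _ => N) (fun i => g (d i)) b)
    (fun ψ => h ⟨k, ψ, d⟩) (φ.subst σ)
  rw [key, key] at this
  exact this.symm

/-- Points of extensions that satisfy the same conditions can be identified. -/
theorem atEquiv_of_condSet_eq {T : Set (τ.Fml 0)} (hD : Mod (Tstar T) D inferInstance)
    {P Q : PointedExt (Mod (Tstar T)) D} (h : P.condSet = Q.condSet) :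
    AtEquiv (Mod (Tstar T)) P Q := by
  have := hD.1
  have := P.mem.1
  have := Q.mem.1
  obtain ⟨_, _, hP⟩ := exists_isPlus (τ := τ) (M := P.N) fun σ hσ => P.mem.2 σ (.inl hσ)
  obtain ⟨_, _, hQ⟩ := exists_isPlus (τ := τ) (M := Q.N) fun σ hσ => Q.mem.2 σ (.inl hσ)
  have hPQ := sameType_option_elim (τ := τ) P.emb Q.emb P.a Q.a fun C hC =>
    (hQ.relMap_leZero _ _).1 (show C ∈ Q.condSet from h ▸ (hP.relMap_leZero _ _).2 hC)
  obtain ⟨N, _, _, f, g, hf, hg⟩ := exists_joint_extension (P := PUnit) _ (fun _ => Q.N) _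
    fun _ => hPQ
  let _ := plusStructure τ N
  have hN : IsPlus τ N := isPlus_plusStructure
  refine ⟨N, plusStructure τ N, hN.mod_Tstar_iff.2 fun φ hφ => ?_, hf.embedding hP hN,
    (hg ⟨⟩).1.embedding hQ hN, fun m => ((hg ⟨⟩).2 (some m)).symm, ((hg ⟨⟩).2 none).symm⟩
  exact (peval_closed_eq_zero_iff hf φ).2 (hP.mod_Tstar_iff.1 P.mem φ hφ)

end GaloisTypes

/-! ### The two implications -/

section Main

variable {T : Set (τ.Fml 0)} {κ : Cardinal.{u}}

theorem DiscreteStable.galoisStable (h : DiscreteStable T κ) : GaloisStable (Mod (Tstar T)) κ := by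
  intro D _ hD hcard
  have := hD.1
  obtain ⟨_, _, hp⟩ := exists_isPlus (τ := τ) (M := D) fun σ hσ => hD.2 σ (.inl hσ)
  have hcoe := isElem_coe_completion (τ := τ) (M := D)
  let A : Set (UniformSpace.Completion D) := Set.range ((↑) : D → UniformSpace.Completion D)
  have hstable := h (UniformSpace.Completion D) (fun φ hφ => by
    rw [← peval_eq_eval]
    exact (peval_closed_eq_zero_iff hcoe φ).2 (hp.mod_Tstar_iff.1 hD φ hφ)) A
    (mk_range_le.trans_eq hcard)
  -- This is the inverse of the inclusion of `D` into its completion, which is injective because `D`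
  -- is a metric space.
  choose r hr using fun a : A => a.2
  let tp : PointedExt (Mod (Tstar T)) D → Set (Cond τ A) := fun P =>
    {C | (⟨C.1, C.2.1, fun i => r (C.2.2 i)⟩ : Cond τ D) ∈ P.condSet}
  have htp : ∀ P, tp P ∈ typeSpace τ A := by
    intro P
    have := P.mem.1
    obtain ⟨_, _, hP⟩ := exists_isPlus (τ := τ) (M := P.N) fun σ hσ => P.mem.2 σ (.inl hσ)
    have hemb := hp.isElem_embedding hP P.emb
    have hcoe' := isElem_coe_completion (τ := τ) (M := P.N)
    refine ⟨UniformSpace.Completion P.N, inferInstance, inferInstance, fun a => (P.emb (r a) : P.N),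
      fun k φ a ha => ?_, (P.a : P.N), ?_⟩
    · rw [← peval_eq_eval] at ha ⊢
      rw [hcoe' k φ fun i => P.emb (r (a i)), hemb k φ fun i => r (a i),
        ← hcoe k φ fun i => r (a i)]
      simpa only [hr] using ha
    · ext C
      refine (hP.relMap_leZero _ _).trans ?_
      rw [Set.mem_ofPred_eq, ← peval_eq_eval, hcoe'.peval_snoc C.2.1 (fun i => P.emb (r (C.2.2 i)))]
  have htp_inj : ∀ P Q, tp P = tp Q → AtEquiv (Mod (Tstar T)) P Q := by
    intro P Q hPQ
    refine atEquiv_of_condSet_eq hD ?_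
    ext ⟨k, φ, d⟩
    have hrd : ∀ x : D, r ⟨x, x, rfl⟩ = x := fun x =>
      UniformSpace.Completion.coe_injective D (hr ⟨x, x, rfl⟩)
    have := Set.ext_iff.1 hPQ ⟨k, φ, fun i => ⟨d i, d i, rfl⟩⟩
    simpa only [tp, Set.mem_ofPred_eq, hrd] using this
  -- Representatives are chosen, so only injectivity has to be checked: equal types make the
  -- representatives equivalent.
  let F : GaloisType (Mod (Tstar T)) D → ULift.{u + 1} (typeSpace τ A) := fun q =>
    ⟨⟨tp q.out, htp q.out⟩⟩
  have hF : Function.Injective F := fun q q' hqq => by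
    have h1 : tp q.out = tp q'.out := congrArg (fun z => z.down.1) hqq
    rw [← q.out_eq, ← q'.out_eq]
    exact Quot.sound (htp_inj _ _ h1)
  refine (mk_le_of_injective hF).trans ?_
  rw [mk_uLift]
  exact lift_le.2 hstable

theorem GaloisStable.discreteStable (hκ : max ℵ₀ τ.card ≤ κ)
    (h : GaloisStable (Mod (Tstar T)) κ) : DiscreteStable T κ := by
  intro M _ _ hM A hA
  have h0 := (le_max_left _ _).trans hκ
  choose N mN sN c hc e he using fun p : typeSpace τ A => p.2
  have hsame : ∀ p, SameType τ (Subtype.val : A → M) (c p) := fun p k φ a =>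
    (peval_eq_of_zero_imp (fun ψ hψ => by
      rw [peval_eq_eval] at hψ ⊢
      exact hc p k ψ a hψ) φ).symm
  obtain ⟨Q, _, _, f, g, hf, hg⟩ := exists_joint_extension _ N c hsame
  have hp : ∀ (p : typeSpace τ A) (C : Cond τ A), C ∈ p.1 ↔
      peval C.2.1 (Fin.snoc (α := fun _ => Q) (fun i => f (C.2.2 i)) (g p (e p))) = 0 := by
    intro p C
    rw [he p, Set.mem_ofPred_eq, ← peval_eq_eval, ← (hg p).1.peval_snoc]
    simp only [(hg p).2]
  -- If `Q` is small, it may have no substructure of size `κ`; but distinct types have distinct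
  -- realizations in `Q`, which bounds their number directly.
  rcases le_or_gt #Q κ with hQ | hQ
  · refine (mk_le_of_injective (f := fun p => g p (e p)) fun p p' hpp => ?_).trans hQ
    refine Subtype.ext (Set.ext fun C => ?_)
    rw [hp, hp, show g p (e p) = g p' (e p') from hpp]
  -- Galois stability speaks of models of size exactly `κ`; `S` is padding that forces this size.
  obtain ⟨S, hS⟩ := le_mk_iff_exists_set.1 hQ.le
  have hSne : S.Nonempty :=
    Set.nonempty_coe_sort.1 (mk_ne_zero_iff.1 (hS.trans_ne (aleph0_pos.trans_le h0).ne'))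
  obtain ⟨D, hSD, hDκ, _, hD⟩ := exists_elementary_subset hκ (S ∪ f '' A) hSne.inl
    ((mk_union_le _ _).trans (add_le_of_le h0 hS.le (mk_image_le.trans hA)))
  have hDcard : #D = κ :=
    le_antisymm hDκ (hS.symm.trans_le (mk_le_mk_of_subset (Set.subset_union_left.trans hSD)))
  let _ := plusStructure τ D
  let _ := plusStructure τ Q
  have hDp : IsPlus τ D := isPlus_plusStructure
  have hQp : IsPlus τ Q := isPlus_plusStructure
  have hQT : ∀ φ ∈ T, peval (M := Q) φ Fin.elim0 = 0 := fun φ hφ =>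
    (peval_closed_eq_zero_iff hf φ).2 ((peval_eq_eval φ _).trans (hM φ hφ))
  have hDT : ∀ φ ∈ T, peval (M := D) φ Fin.elim0 = 0 := fun φ hφ =>
    (peval_closed_eq_zero_iff hD φ).1 (hQT φ hφ)
  have hgal := h D (hDp.mod_Tstar_iff.2 hDT) hDcard
  -- The structure `Q` itself, pointed at a realization, represents the Galois type over `D`;
  -- restricting its conditions to parameters in `f '' A` gives back the type over `A`.
  let ext : Q → PointedExt (Mod (Tstar T)) D := fun a =>
    { N := Q, mem := hQp.mod_Tstar_iff.2 hQT, emb := hD.embedding hDp hQp, a := a }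
  let F : ULift.{u + 1} (typeSpace τ A) → GaloisType (Mod (Tstar T)) D := fun p =>
    Quot.mk _ (ext (g p.down (e p.down)))
  have hF : Function.Injective F := by
    rintro ⟨p⟩ ⟨p'⟩ hpp
    have h1 : (ext (g p (e p))).condSet = (ext (g p' (e p'))).condSet :=
      congrArg (Quot.lift PointedExt.condSet fun _ _ => AtEquiv.condSet_eq) hpp
    refine congrArg ULift.up (Subtype.ext (Set.ext fun C => ?_))
    have h2 := Set.ext_iff.1 h1 ⟨C.1, C.2.1, fun i =>
      ⟨f (C.2.2 i), hSD (.inr ⟨_, (C.2.2 i).2, rfl⟩)⟩⟩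
    exact (hp p C).trans (((hQp.relMap_leZero _ _).symm.trans
      (h2.trans (hQp.relMap_leZero _ _))).trans (hp p' C).symm)
  have h3 := (mk_le_of_injective hF).trans hgal
  rw [mk_uLift] at h3
  exact lift_le.1 h3

end Main

end ContLogic

theorem mainTheorem10 (τ : ContLogic.Lang.{u}) (T : Set (τ.Fml 0)) (κ : Cardinal.{u})
    (hκ : max Cardinal.aleph0 τ.card ≤ κ) :
    ContLogic.DiscreteStable T κ ↔
      ContLogic.GaloisStable (ContLogic.Mod (ContLogic.Tstar T)) κ :=
  ⟨fun h => h.galoisStable, fun h => h.discreteStable hκ⟩
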